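/- **Theorem 2 (Probability Density Function).** For $i=1,2$ let $I_i$ be independent random variables with the mixture Exponential–Generalized Gamma densities $$f_{I_i}(x)=\frac{\omega_i}{\lambda_i}e^{-x/\lambda_i}+(1-\omega_i)\frac{c_i\,x^{a_ic_i-1}}{b_i^{a_ic_i}\Gamma(a_i)}e^{-(x/b_i)^{c_i}},\qquad x>0,$$ where $0<\omega_i<1$ and $\lambda_i,a_i,b_i,c_i>0$. Let $r_i\in\{1,2\}$, $\eta,N_{0_i},C>0$, let $\gamma_i=(\eta I_i)^{r_i}/N_{0_i}$ be the SNR of the $i$-th hop, let $\mu_{r_i}=\eta^{r_i}/N_{0_i}$ be its average electrical SNR, and let $\gamma=\gamma_1\gamma_2/(\gamma_2+C)$ be the end-to-end SNR. Then $\mu_{r_i}=\mathbb E[\gamma_i]$ if $r_i=1$ and $\mathbb E[I_i]=1$, and $\mu_{r_i}=\mathbb E[\gamma_i]/\big(2\omega_i\lambda_i^2+b_i^2(1-\omega_i)\Gamma(a_i+2/c_i)/\Gamma(a_i)\big)$ if $r_i=2$. Write, for $x,y>0$ and $\alpha,\beta,A,B>0$, $$\mathcal H_{\alpha,A;\beta,B}(x,y)=\mathrm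 H^{0,1:0,1:2,0}_{1,0:1,1:0,2}\left[\begin{matrix}(1;1,1)\\ -\end{matrix}\middle|\begin{matrix}(1-\alpha,A)\\(1,1)\end{matrix}\middle|\begin{matrix}-\\(0,1)(\beta,B)\end{matrix}\middle|\,x,y\right]=\frac1{(2\pi i)^2}\int_{\mathcal C_1}\int_{\mathcal C_2}\frac{\Gamma(\alpha+As)}{\Gamma(s)}\Gamma(-t)\Gamma(\beta-Bt)\Gamma(s+t)\,x^s y^t\,dt\,ds$$ for the bivariate Fox H-function with these parameters, where $\mathcal C_1,\mathcal C_2$ are upward vertical lines that separate the poles: $\operatorname{Re}(\alpha+As)>0$, $\operatorname{Re}t<0$, $\operatorname{Re}(\beta-Bt)>0$, $\operatorname{Re}(s+t)>0$. Such lines exist. For the parameters and arguments occurring below, the integral converges absolutely for all of them, and its value does not depend on their choice. The law of $\gamma$ is absolutely continuous, with a nonnegative density $f_\gamma$ that vanishes on $(-\infty,0]$ and is given for every $\gamma>0$ by $$\begin{aligned}f_\gamma(\gamma)={}&\frac{\omega_1\omega_2}{\gamma}\,\mathcal H_{1,r_1;1,r_2}\Big(\frac{\lambda_1^{r_1}\mu_{r_1}}{\gamma},\frac{C}{\lambda_2^{r_2}\mu_{r_2}}\Big)+\frac{\omega_1(1-\omega_2)}{\Gamma(a_2)\gamma}\,\mathcal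 H_{1,r_1;a_2,r_2/c_2}\Big(\frac{\lambda_1^{r_1}\mu_{r_1}}{\gamma},\frac{C}{b_2^{r_2}\mu_{r_2}}\Big)\\&+\frac{\omega_2(1-\omega_1)}{\Gamma(a_1)\gamma}\,\mathcal H_{a_1,r_1/c_1;1,r_2}\Big(\frac{b_1^{r_1}\mu_{r_1}}{\gamma},\frac{C}{\lambda_2^{r_2}\mu_{r_2}}\Big)+\frac{(1-\omega_1)(1-\omega_2)}{\Gamma(a_1)\Gamma(a_2)\gamma}\,\mathcal H_{a_1,r_1/c_1;a_2,r_2/c_2}\Big(\frac{b_1^{r_1}\mu_{r_1}}{\gamma},\frac{C}{b_2^{r_2}\mu_{r_2}}\Big).\end{aligned}$$ Moreover, the cumulative distribution function of $\gamma$ is differentiable at every point of $(0,\infty)$, with derivative $f_\gamma$. -/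

import Mathlib

open MeasureTheory ProbabilityTheory

noncomputable section

/-! ### Fox's H-function of two variables -/

/-- Parameters attached to one of the two variables of a bivariate Fox H-function
`H^{…:m,n:…}_{…:p,q:…}`: the upper parameters `(c_j, γ_j)`, `j ≤ n` (`upperNum`) and
`n < j ≤ p` (`upperDen`), and the lower parameters `(d_j, δ_j)`, `j ≤ m` (`lowerNum`) and
`m < j ≤ q` (`lowerDen`). The indices `m, n, p, q` are read off from the lengths of the lists. -/
structure FoxParams where
  upperNum : List (ℂ × ℝ)
  upperDen : List (ℂ × ℝ)
  lowerNum : List (ℂ × ℝ)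
  lowerDen : List (ℂ × ℝ)

/-- Parameters attached to both variables jointly in `H^{0,n:…}_{p,q:…}`: the upper ones
`(a_j; α_j, A_j)`, `j ≤ n` (`upperNum`) and `n < j ≤ p` (`upperDen`), and the lower ones
`(b_j; β_j, B_j)`, `j ≤ q` (`lower`). -/
structure FoxJointParams where
  upperNum : List (ℂ × ℝ × ℝ)
  upperDen : List (ℂ × ℝ × ℝ)
  lower : List (ℂ × ℝ × ℝ)

/-- `∏_{j≤m} Γ(d_j - δ_j s) ∏_{j≤n} Γ(1 - c_j + γ_j s) /
(∏_{j>m} Γ(1 - d_j + δ_j s) ∏_{j>n} Γ(c_j - γ_j s))`. -/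
def FoxParams.kernel (A : FoxParams) (s : ℂ) : ℂ :=
  ((A.lowerNum.map fun d => Complex.Gamma (d.1 - d.2 * s)).prod *
    (A.upperNum.map fun c => Complex.Gamma (1 - c.1 + c.2 * s)).prod) /
  ((A.lowerDen.map fun d => Complex.Gamma (1 - d.1 + d.2 * s)).prod *
    (A.upperDen.map fun c => Complex.Gamma (c.1 - c.2 * s)).prod)

/-- `∏_{j≤n} Γ(1 - a_j + α_j s + A_j t) /
(∏_{j>n} Γ(a_j - α_j s - A_j t) ∏_{j≤q} Γ(1 - b_j + β_j s + B_j t))`. -/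
def FoxJointParams.kernel (J : FoxJointParams) (s t : ℂ) : ℂ :=
  (J.upperNum.map fun a => Complex.Gamma (1 - a.1 + a.2.1 * s + a.2.2 * t)).prod /
  ((J.upperDen.map fun a => Complex.Gamma (a.1 - a.2.1 * s - a.2.2 * t)).prod *
    (J.lower.map fun b => Complex.Gamma (1 - b.1 + b.2.1 * s + b.2.2 * t)).prod)

/-- The vertical line of abscissa `σ` has the poles of all `Γ(1 - c_j + γ_j s)` strictly on its
left and those of all `Γ(d_j - δ_j s)` strictly on its right (the coefficients being positive). -/
def FoxParams.Separates (A : FoxParams) (σ : ℝ) : Prop :=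
  (∀ c ∈ A.upperNum, 0 < 1 - c.1.re + c.2 * σ) ∧ (∀ d ∈ A.lowerNum, 0 < d.1.re - d.2 * σ)

/-- The vertical lines `Re s = σ`, `Re t = τ` are admissible Mellin-Barnes contours: besides the
separation in each variable, the poles of the `Γ(1 - a_j + α_j s + A_j t)` lie on the left. -/
def FoxSeparates (J : FoxJointParams) (A B : FoxParams) (σ τ : ℝ) : Prop :=
  (∀ a ∈ J.upperNum, 0 < 1 - a.1.re + a.2.1 * σ + a.2.2 * τ) ∧ A.Separates σ ∧ B.Separates τ

/-- The Mellin-Barnes integrand. -/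
def foxIntegrand (J : FoxJointParams) (A B : FoxParams) (x y : ℝ) (s t : ℂ) : ℂ :=
  J.kernel s t * A.kernel s * B.kernel t * (x : ℂ) ^ s * (y : ℂ) ^ t

/-- `(2πi)⁻² ∫_{Re s = σ} ∫_{Re t = τ} (integrand) dt ds`, with `s = σ + i u`, `t = τ + i v`. -/
def foxContourIntegral (J : FoxJointParams) (A B : FoxParams) (x y σ τ : ℝ) : ℂ :=
  1 / (2 * Real.pi * Complex.I) ^ 2 *
    ∫ u : ℝ, (∫ v : ℝ, foxIntegrand J A B x y (σ + u * Complex.I) (τ + v * Complex.I)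
      * Complex.I) * Complex.I

open Classical in
/-- Fox's H-function of two variables `H[J | A | B | x, y]` for `x, y > 0`: the Mellin-Barnes
integral along vertical lines that separate the poles. -/
def bivariateFoxH (J : FoxJointParams) (A B : FoxParams) (x y : ℝ) : ℂ :=
  if h : ∃ z : ℝ × ℝ, FoxSeparates J A B z.1 z.2 then
    foxContourIntegral J A B x y h.choose.1 h.choose.2
  else 0

/-- `H[J | A | B | x, y]` is well defined: separating lines exist, and along any of them the
integral converges absolutely to one and the same value. -/
def BivariateFoxHConverges (J : FoxJointParams) (A B : FoxParams) (x y : ℝ) : Prop :=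
  (∃ σ τ : ℝ, FoxSeparates J A B σ τ) ∧
  ∀ σ τ : ℝ, FoxSeparates J A B σ τ →
    Integrable (fun z : ℝ × ℝ =>
      foxIntegrand J A B x y (σ + z.1 * Complex.I) (τ + z.2 * Complex.I)) ∧
    foxContourIntegral J A B x y σ τ = bivariateFoxH J A B x y

/-! ### The channel model -/

/-- Parameters of a mixture Exponential-Generalized Gamma (EGG) distribution. -/
structure EGGParams where
  ω : ℝ
  lam : ℝ
  a : ℝ
  b : ℝ
  c : ℝ
  ω_pos : 0 < ω
  ω_lt_one : ω < 1
  lam_pos : 0 < lam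
  a_pos : 0 < a
  b_pos : 0 < b
  c_pos : 0 < c

/-- The density of the EGG distribution, supported on the positive half-line. -/
def eggPDF (p : EGGParams) (x : ℝ) : ℝ :=
  if 0 < x then
    p.ω / p.lam * Real.exp (-(x / p.lam)) +
      (1 - p.ω) * (p.c * x ^ (p.a * p.c - 1) / (p.b ^ (p.a * p.c) * Real.Gamma p.a)) *
        Real.exp (-((x / p.b) ^ p.c))
  else 0

/-- The EGG distribution. -/
def eggMeasure (p : EGGParams) : Measure ℝ :=
  volume.withDensity fun x => ENNReal.ofReal (eggPDF p x)

/-- The instantaneous SNR `(η I)^r / N₀` of a hop with irradiance `I`, conversion ratio `η`,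
noise power `N₀` and detection type `r` (`1`: heterodyne, `2`: IM/DD). -/
def hopSNR {Ω : Type*} (η N₀ : ℝ) (r : ℕ) (I : Ω → ℝ) (w : Ω) : ℝ :=
  (η * I w) ^ r / N₀

/-- The average electrical SNR `μ_r = η^r / N₀` of a hop, i.e. the SNR at normalized mean
irradiance `1`. -/
def avgElectricalSNR (η N₀ : ℝ) (r : ℕ) : ℝ :=
  η ^ r / N₀

/-- The end-to-end SNR `γ₁ γ₂ / (γ₂ + C)` of a dual-hop link with a fixed-gain relay. -/
def endToEndSNR {Ω : Type*} (C : ℝ) (γ₁ γ₂ : Ω → ℝ) (w : Ω) : ℝ :=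
  γ₁ w * γ₂ w / (γ₂ w + C)

/-- The expressions of `μ` through the mean SNR: `μ = E[γ]` for `r = 1` and irradiance of mean
`1`, and `μ = E[γ] / (2 ω λ² + b² (1 - ω) Γ(a + 2/c) / Γ(a))` for `r = 2`. -/
def AvgElectricalSNRSpec {Ω : Type*} [MeasurableSpace Ω] (P : Measure Ω) (p : EGGParams)
    (r : ℕ) (I γ : Ω → ℝ) (μ : ℝ) : Prop :=
  (r = 1 → ∫ w, I w ∂P = 1 → μ = ∫ w, γ w ∂P) ∧
  (r = 2 → μ = (∫ w, γ w ∂P) /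
    (2 * p.ω * p.lam ^ 2 + p.b ^ 2 * (1 - p.ω) * Real.Gamma (p.a + 2 / p.c) / Real.Gamma p.a))

/-! ### The four H-functions of the density -/

/-- `(1; 1, 1)` above, nothing below. -/
def jointPar : FoxJointParams := ⟨[(1, 1, 1)], [], []⟩

/-- First variable, exponential component: `(0, r)` above, `(1, 1)` below; `m = 0`, `n = 1`. -/
def firstExpPar (r : ℕ) : FoxParams := ⟨[(0, (r : ℝ))], [], [], [(1, 1)]⟩

/-- First variable, generalized Gamma component: `(1 - a, r / c)` above, `(1, 1)` below;
`m = 0`, `n = 1`. -/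
def firstGGPar (p : EGGParams) (r : ℕ) : FoxParams :=
  ⟨[(1 - (p.a : ℂ), (r : ℝ) / p.c)], [], [], [(1, 1)]⟩

/-- Second variable, exponential component: nothing above, `(0, 1), (1, r)` below;
`m = 2`, `n = 0`. -/
def secondExpPar (r : ℕ) : FoxParams := ⟨[], [], [(0, 1), (1, (r : ℝ))], []⟩

/-- Second variable, generalized Gamma component: nothing above, `(0, 1), (a, r / c)` below;
`m = 2`, `n = 0`. -/
def secondGGPar (p : EGGParams) (r : ℕ) : FoxParams :=
  ⟨[], [], [(0, 1), ((p.a : ℂ), (r : ℝ) / p.c)], []⟩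

/-- The closed form of the density of the end-to-end SNR at `x > 0`. -/
def endToEndSNRDensity (p₁ p₂ : EGGParams) (r₁ r₂ : ℕ) (μ₁ μ₂ C x : ℝ) : ℂ :=
  (p₁.ω * p₂.ω / x : ℝ) *
      bivariateFoxH jointPar (firstExpPar r₁) (secondExpPar r₂)
        (p₁.lam ^ r₁ * μ₁ / x) (C / (p₂.lam ^ r₂ * μ₂)) +
  (p₁.ω * (1 - p₂.ω) / (Real.Gamma p₂.a * x) : ℝ) *
      bivariateFoxH jointPar (firstExpPar r₁) (secondGGPar p₂ r₂)
        (p₁.lam ^ r₁ * μ₁ / x) (C / (p₂.b ^ r₂ * μ₂)) +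
  (p₂.ω * (1 - p₁.ω) / (Real.Gamma p₁.a * x) : ℝ) *
      bivariateFoxH jointPar (firstGGPar p₁ r₁) (secondExpPar r₂)
        (p₁.b ^ r₁ * μ₁ / x) (C / (p₂.lam ^ r₂ * μ₂)) +
  ((1 - p₁.ω) * (1 - p₂.ω) / (Real.Gamma p₁.a * Real.Gamma p₂.a * x) : ℝ) *
      bivariateFoxH jointPar (firstGGPar p₁ r₁) (secondGGPar p₂ r₂)
        (p₁.b ^ r₁ * μ₁ / x) (C / (p₂.b ^ r₂ * μ₂))

/-- Well-definedness of the four H-functions in the closed form of the density at `x`. -/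
def EndToEndSNRDensityConverges (p₁ p₂ : EGGParams) (r₁ r₂ : ℕ) (μ₁ μ₂ C x : ℝ) : Prop :=
  BivariateFoxHConverges jointPar (firstExpPar r₁) (secondExpPar r₂)
      (p₁.lam ^ r₁ * μ₁ / x) (C / (p₂.lam ^ r₂ * μ₂)) ∧
  BivariateFoxHConverges jointPar (firstExpPar r₁) (secondGGPar p₂ r₂)
      (p₁.lam ^ r₁ * μ₁ / x) (C / (p₂.b ^ r₂ * μ₂)) ∧
  BivariateFoxHConverges jointPar (firstGGPar p₁ r₁) (secondExpPar r₂)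
      (p₁.b ^ r₁ * μ₁ / x) (C / (p₂.lam ^ r₂ * μ₂)) ∧
  BivariateFoxHConverges jointPar (firstGGPar p₁ r₁) (secondGGPar p₂ r₂)
      (p₁.b ^ r₁ * μ₁ / x) (C / (p₂.b ^ r₂ * μ₂))

end

noncomputable section

open Set Filter Topology
open scoped ENNReal

/-! ### Bounds for the Gamma function on vertical lines -/

/-! An EGG variable is a mixture of scaled powers of Gamma variables: `λ G` with `G` of shape 1, and
`b G^(1/c)` with `G` of shape `a` (`lintegral_eggMeasure`). For one pair of components, with Gamma
variables `h` and `g`, the identity `γ₁γ₂/(γ₂+C) = γ₁/(1+C/γ₂)` gives `γ = K h^A / (1 + g^(-B) y)`.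
For fixed `g` this is again a scaled power of `h`, with an explicit density built on
`powGammaKernel`; averaging over `g` yields `foxValue / z` (`gammaLIntegral_relaySNR`). The density
of `γ` is thus a combination of four such real integrals.

The H-functions are evaluated to the same integrals by two Mellin inversions. For fixed `s`, put `w
= -t`: `Γ(s+t)Γ(-t)/Γ(s)` is the Beta function, the Mellin transform of `(1+z)^(-s)`, and the factor
`Γ(β+Bw)` comes from averaging over the dilations `g^(-B)` with weight `g^(β-1) e^(-g)`. Inversion
in `t` leaves `relayMoment`. Since `Γ(α+As)` is the Mellin transform of `powGammaKernel`, inversion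
in `s` under the `g`-integral leaves `foxValue` (`IsRelayFox.contourIntegral_eq`). The result does
not involve the abscissas, so independence of the contours needs no shifting. Absolute convergence
holds because the Beta factor is bounded along the lines and the other two Gamma factors are
integrable on them.

Finally `powGammaKernel` is bounded, so by dominated convergence the density is continuous on the
positive half-line, and the distribution function is differentiable there. -/

lemma Complex.norm_Gamma_le_Gamma_re {z : ℂ} (hz : 0 < z.re) :
    ‖Complex.Gamma z‖ ≤ Real.Gamma z.re := by
  rw [Complex.Gamma_eq_integral hz, Complex.GammaIntegral, Real.Gamma_eq_integral hz]
  refine (norm_integral_le_integral_norm _).trans_eq ?_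
  refine setIntegral_congr_fun measurableSet_Ioi fun x hx => ?_
  have hx : (0 : ℝ) < x := hx
  simp [Complex.norm_cpow_eq_rpow_re_of_pos hx, Complex.norm_exp]

lemma Complex.continuous_Gamma_comp {X : Type*} [TopologicalSpace X] {f : X → ℂ}
    (hf : Continuous f) (h : ∀ x, 0 < (f x).re) : Continuous fun x => Complex.Gamma (f x) := by
  refine continuous_iff_continuousAt.2 fun x => ?_
  refine ContinuousAt.comp (f := f) (Complex.differentiableAt_Gamma _ fun m hm => ?_).continuousAt
    hf.continuousAt
  have := h x
  rw [hm] at this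
  simp at this
  linarith [Nat.cast_nonneg (α := ℝ) m]

/-- Two steps of the functional equation give `Γ(z) = Γ(z+2)/(z(z+1))`. The numerator is bounded by
`Γ(a+2)` and the denominator grows quadratically; this decay suffices, without Stirling's formula.
-/
lemma Complex.integrable_Gamma_vertical {a : ℝ} (ha : 0 < a) :
    Integrable fun u : ℝ => Complex.Gamma (a + u * Complex.I) := by
  have hcont : Continuous fun u : ℝ => Complex.Gamma (a + u * Complex.I) :=
    Complex.continuous_Gamma_comp (by fun_prop) (by simp [ha])
  -- Chosen so that `m(1+u²) ≤ a²+u² = ‖z‖²`.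
  set m : ℝ := min (a ^ 2) 1
  have hm : 0 < m := by positivity
  refine ((integrable_inv_one_add_sq).const_mul (Real.Gamma (a + 2) / m)).mono'
    hcont.aestronglyMeasurable (Eventually.of_forall fun u => ?_)
  set z : ℂ := a + u * Complex.I
  have hre : z.re = a := by simp [z]
  have him : z.im = u := by simp [z]
  have hz : z ≠ 0 := fun h => by rw [h] at hre; simp at hre; linarith
  have hz1 : z + 1 ≠ 0 := fun h => by
    have : (z + 1).re = 0 := by rw [h]; simp
    simp [hre] at this; linarith
  have e : Complex.Gamma (z + 2) = (z + 1) * (z * Complex.Gamma z) := by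
    rw [← Complex.Gamma_add_one z hz, ← Complex.Gamma_add_one _ hz1]; ring_nf
  have hb := Complex.norm_Gamma_le_Gamma_re (z := z + 2) (by simp [hre]; linarith)
  rw [e, norm_mul, norm_mul] at hb
  simp only [Complex.add_re, hre, Complex.re_ofNat] at hb
  have n0 : m * (1 + u ^ 2) ≤ ‖z‖ ^ 2 := by
    rw [← Complex.normSq_eq_norm_sq, Complex.normSq_apply, hre, him]
    nlinarith [min_le_left (a ^ 2) 1, min_le_right (a ^ 2) 1, sq_nonneg u]
  have n1 : ‖z‖ ≤ ‖z + 1‖ := by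
    rw [← sq_le_sq₀ (norm_nonneg _) (norm_nonneg _), ← Complex.normSq_eq_norm_sq,
      ← Complex.normSq_eq_norm_sq, Complex.normSq_apply, Complex.normSq_apply]
    simp [hre]; nlinarith
  have : m * (1 + u ^ 2) * ‖Complex.Gamma z‖ ≤ Real.Gamma (a + 2) := by
    refine le_trans ?_ hb
    rw [← mul_assoc]
    refine mul_le_mul_of_nonneg_right (n0.trans ?_) (norm_nonneg _)
    nlinarith [norm_nonneg z]
  rw [← div_eq_mul_inv, div_div, le_div_iff₀ (by positivity)]
  linarith

lemma Complex.integrable_Gamma_vertical_mul {a A : ℝ} (ha : 0 < a) (hA : A ≠ 0) :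
    Integrable fun u : ℝ => Complex.Gamma (a + A * u * Complex.I) := by
  simpa using (Complex.integrable_Gamma_vertical ha).comp_mul_left' hA

/-! ### Mellin transforms of superpositions of dilations -/

section Superposition

variable {h c : ℝ → ℂ} {Q : ℝ → ℝ} {w : ℂ}

/-- Isolates the factor `q`, which is the Jacobian of the substitution `y ↦ q y`. -/
lemma cpow_dilation {q : ℝ} (hq : 0 < q) {y : ℝ} (hy : 0 < y) (w : ℂ) (z : ℂ) :
    (y : ℂ) ^ (w - 1) * z = (q : ℂ) ^ (-w) * (q * ((((q * y : ℝ) : ℂ)) ^ (w - 1) * z)) := by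
  have hq' : (q : ℂ) ≠ 0 := by exact_mod_cast hq.ne'
  rw [Complex.ofReal_mul, Complex.mul_cpow_ofReal_nonneg hq.le hy.le, Complex.cpow_sub _ _ hq',
    Complex.cpow_neg]
  have : (q : ℂ) ^ w ≠ 0 := by simp [Complex.cpow_eq_zero_iff, hq']
  field_simp
  simp [hq']

/-- The joint integrand of the Mellin transform of `y ↦ ∫ c(g) h(Q(g) y) dg` is integrable. -/
lemma integrable_superposition (hh : MellinConvergent h w) (hhm : Measurable h)
    (hcm : Measurable c) (hQm : Measurable Q) (hQ : ∀ g, 0 < g → 0 < Q g)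
    (hc : IntegrableOn (fun g => (Q g : ℂ) ^ (-w) * c g) (Ioi 0)) :
    Integrable (fun z : ℝ × ℝ => (z.1 : ℂ) ^ (w - 1) * (c z.2 * h (Q z.2 * z.1)))
      ((volume.restrict (Ioi 0)).prod (volume.restrict (Ioi 0))) := by
  have hm : Measurable (fun z : ℝ × ℝ => (z.1 : ℂ) ^ (w - 1) * (c z.2 * h (Q z.2 * z.1))) := by
    fun_prop
  rw [integrable_prod_iff' hm.aestronglyMeasurable]
  constructor
  · filter_upwards [ae_restrict_mem measurableSet_Ioi] with g hg
    have := ((MellinConvergent.comp_mul_left (hQ g hg)).2 hh).const_smul (c g)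
    simpa [MellinConvergent, IntegrableOn] using this
  · have key : ∀ g ∈ Ioi (0 : ℝ), ∫ y in Ioi (0 : ℝ), ‖(y : ℂ) ^ (w - 1) * (c g * h (Q g * y))‖ =
        ‖(Q g : ℂ) ^ (-w) * c g‖ * ∫ y in Ioi (0 : ℝ), ‖(y : ℂ) ^ (w - 1) * h y‖ := by
      intro g hg
      have hq := hQ g hg
      have h1 : ∀ y ∈ Ioi (0 : ℝ), ‖(y : ℂ) ^ (w - 1) * (c g * h (Q g * y))‖ =
          ‖(Q g : ℂ) ^ (-w) * c g‖ * Q g *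
            ‖(((Q g * y : ℝ) : ℂ)) ^ (w - 1) * h (Q g * y)‖ := by
        intro y hy
        rw [cpow_dilation hq hy]
        simp only [norm_mul, Complex.norm_real, Real.norm_of_nonneg hq.le]
        ring
      rw [setIntegral_congr_fun measurableSet_Ioi h1, integral_const_mul,
        integral_comp_mul_left_Ioi (fun y : ℝ => ‖(y : ℂ) ^ (w - 1) * h y‖) 0 hq]
      simp only [mul_zero, smul_eq_mul]
      field_simp
    refine Integrable.congr (hc.norm.mul_const
      (∫ y in Ioi (0 : ℝ), ‖(y : ℂ) ^ (w - 1) * h y‖)) ?_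
    filter_upwards [ae_restrict_mem measurableSet_Ioi] with g hg
    exact (key g hg).symm

/-- Dilating `h` by `Q g` multiplies its Mellin transform by `(Q g)^(-w)`; Fubini does the rest. It
serves for the Beta integral (`Q = id`) and for `relayMoment` (`Q g = g^(-B)`). -/
lemma hasMellin_superposition (hh : MellinConvergent h w) (hhm : Measurable h)
    (hcm : Measurable c) (hQm : Measurable Q) (hQ : ∀ g, 0 < g → 0 < Q g)
    (hc : IntegrableOn (fun g => (Q g : ℂ) ^ (-w) * c g) (Ioi 0)) :
    HasMellin (fun y => ∫ g in Ioi (0 : ℝ), c g * h (Q g * y)) w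
      ((∫ g in Ioi (0 : ℝ), (Q g : ℂ) ^ (-w) * c g) * mellin h w) := by
  have hint := integrable_superposition hh hhm hcm hQm hQ hc
  constructor
  · have := hint.integral_prod_left
    simpa [MellinConvergent, IntegrableOn, integral_const_mul] using this
  · simp only [mellin, smul_eq_mul, ← integral_const_mul]
    rw [integral_integral_swap hint, integral_const_mul, ← integral_mul_const]
    refine setIntegral_congr_fun measurableSet_Ioi fun g hg => ?_
    have := mellin_comp_mul_left h w (hQ g hg)
    simp only [mellin, smul_eq_mul] at this
    simp only [mul_left_comm _ (c g), integral_const_mul, this]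
    ring

end Superposition

/-! ### Mellin transforms of the functions at hand -/

lemma hasMellin_exp_neg {w : ℂ} (hw : 0 < w.re) :
    HasMellin (fun x : ℝ => Complex.exp (-x)) w (Complex.Gamma w) := by
  constructor
  · have := Complex.GammaIntegral_convergent hw
    refine this.congr_fun (fun x _ => ?_) measurableSet_Ioi
    simp [mul_comm]
  · rw [Complex.Gamma_eq_integral hw, Complex.GammaIntegral, mellin]
    refine setIntegral_congr_fun measurableSet_Ioi fun x _ => ?_
    simp [mul_comm]

lemma integral_cpow_mul_exp_neg {w : ℂ} (hw : 0 < w.re) :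
    IntegrableOn (fun g : ℝ => (g : ℂ) ^ (w - 1) * Complex.exp (-g)) (Ioi 0) ∧
    ∫ g in Ioi (0 : ℝ), (g : ℂ) ^ (w - 1) * Complex.exp (-g) = Complex.Gamma w := by
  simpa [HasMellin, MellinConvergent, mellin] using hasMellin_exp_neg hw

/-- Superposing the exponentials `e^(-gy)` with weight `g^(s-1) e^(-g)` produces `Γ(s)(1+y)^(-s)`,
so its transform is `Γ(w)Γ(s-w)`. -/
lemma hasMellin_one_add_cpow_neg {s w : ℂ} (hw : 0 < w.re) (hs : w.re < s.re) :
    HasMellin (fun z : ℝ => ((1 + z : ℝ) : ℂ) ^ (-s)) w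
      (Complex.Gamma w * Complex.Gamma (s - w) / Complex.Gamma s) := by
  have hG : Complex.Gamma s ≠ 0 := Complex.Gamma_ne_zero_of_re_pos (hw.trans hs)
  have e : ∀ g ∈ Ioi (0 : ℝ), (g : ℂ) ^ (-w) * ((g : ℂ) ^ (s - 1) * Complex.exp (-g)) =
      (g : ℂ) ^ ((s - w) - 1) * Complex.exp (-g) := fun g hg => by
    have : (g : ℂ) ≠ 0 := by exact_mod_cast (ne_of_gt hg)
    rw [← mul_assoc, ← Complex.cpow_add _ _ this]; ring_nf
  obtain ⟨i1, i2⟩ := integral_cpow_mul_exp_neg (w := s - w) (by simpa using hs)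
  have H := hasMellin_superposition (h := fun x : ℝ => Complex.exp (-x))
    (c := fun g : ℝ => (g : ℂ) ^ (s - 1) * Complex.exp (-g)) (Q := id) (w := w)
    (hasMellin_exp_neg hw).1 (by fun_prop) (by fun_prop) (by fun_prop) (fun g hg => hg)
    (i1.congr_fun (fun g hg => (e g hg).symm) measurableSet_Ioi)
  simp only [id] at H
  rw [setIntegral_congr_fun measurableSet_Ioi e, i2, (hasMellin_exp_neg hw).2] at H
  have M : ∀ y ∈ Ioi (0 : ℝ), ∫ g in Ioi (0 : ℝ), (g : ℂ) ^ (s - 1) * Complex.exp (-g) *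
      Complex.exp (-((g * y : ℝ) : ℂ)) = Complex.Gamma s * ((1 + y : ℝ) : ℂ) ^ (-s) := by
    intro y hy
    have hy : 0 < y := hy
    have := Complex.integral_cpow_mul_exp_neg_mul_Ioi (a := s) (r := 1 + y) (hw.trans hs)
      (by positivity)
    rw [mul_comm, Complex.cpow_neg, ← Complex.inv_cpow, ← one_div]
    · rw [← this]
      refine setIntegral_congr_fun measurableSet_Ioi fun g _ => ?_
      simp only [mul_assoc, ← Complex.exp_add]
      push_cast
      ring_nf
    · rw [Complex.arg_ofReal_of_nonneg (by positivity)]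
      exact Real.pi_pos.ne
  have H' : HasMellin (fun y : ℝ => Complex.Gamma s * ((1 + y : ℝ) : ℂ) ^ (-s)) w
      (Complex.Gamma w * Complex.Gamma (s - w)) := by
    refine ⟨IntegrableOn.congr_fun H.1 (fun y hy => ?_) measurableSet_Ioi, ?_⟩
    · simp only [smul_eq_mul]; rw [← M y hy]
    · rw [mul_comm (Complex.Gamma w), ← H.2]
      refine setIntegral_congr_fun measurableSet_Ioi fun y hy => ?_
      simp only [smul_eq_mul]; rw [← M y hy]
  have := hasMellin_const_smul H'.1 (Complex.Gamma s)⁻¹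
  rw [H'.2] at this
  simpa [hG, div_eq_inv_mul] using this

/-- A bound for the Beta function `Γ(w)Γ(s-w)/Γ(s)` which is uniform on vertical lines. -/
lemma exists_norm_beta_le (σ ρ : ℝ) (hρ : 0 < ρ) (hσ : ρ < σ) : ∃ K, 0 ≤ K ∧ ∀ s w : ℂ,
    s.re = σ → w.re = ρ →
      ‖Complex.Gamma w * Complex.Gamma (s - w) / Complex.Gamma s‖ ≤ K := by
  -- The norm is taken inside the Beta integral, where only the real parts of `s` and `w` survive.
  refine ⟨∫ z in Ioi (0 : ℝ), z ^ (ρ - 1) * (1 + z) ^ (-σ),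
    setIntegral_nonneg measurableSet_Ioi fun z hz => ?_, fun s w hs hw => ?_⟩
  · have hz : 0 < z := hz
    positivity
  · rw [← (hasMellin_one_add_cpow_neg (hw ▸ hρ) (by rw [hs, hw]; exact hσ)).2]
    refine (norm_integral_le_integral_norm _).trans_eq ?_
    refine setIntegral_congr_fun measurableSet_Ioi fun z hz => ?_
    have hz : 0 < z := hz
    simp only [smul_eq_mul, norm_mul]
    rw [Complex.norm_cpow_eq_rpow_re_of_pos hz,
      Complex.norm_cpow_eq_rpow_re_of_pos (by positivity)]
    simp [hs, hw]

lemma ofReal_rpow_cpow {g : ℝ} (hg : 0 < g) (b : ℝ) (w : ℂ) :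
    ((g ^ b : ℝ) : ℂ) ^ w = (g : ℂ) ^ ((b : ℂ) * w) := by
  have : (g : ℂ) ≠ 0 := by exact_mod_cast hg.ne'
  rw [Complex.cpow_def_of_ne_zero (by exact_mod_cast (Real.rpow_pos_of_pos hg b).ne'),
    Complex.cpow_def_of_ne_zero this, ← Complex.ofReal_log (by positivity), Real.log_rpow hg,
    ← Complex.ofReal_log hg.le]
  push_cast; ring_nf

/-- `∫ g^{β-1} e^{-g} (1 + g^{-B} y)^{-s} dg` -/
def relayMoment (β B : ℝ) (s : ℂ) (y : ℝ) : ℂ :=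
  ∫ g in Ioi (0 : ℝ), (g : ℂ) ^ ((β : ℂ) - 1) * Complex.exp (-g) *
    ((1 + g ^ (-B) * y : ℝ) : ℂ) ^ (-s)

/-- A superposition of dilations of `(1+z)^(-s)` by `g^(-B)`: the factor `g^(Bw)` moves the Gamma
exponent from `β` to `β + Bw`. -/
lemma hasMellin_relayMoment {β B : ℝ} (hβ : 0 < β) (hB : 0 < B) {s w : ℂ} (hw : 0 < w.re)
    (hs : w.re < s.re) :
    HasMellin (relayMoment β B s) w
      (Complex.Gamma (β + B * w) *
        (Complex.Gamma w * Complex.Gamma (s - w) / Complex.Gamma s)) := by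
  have e : ∀ g ∈ Ioi (0 : ℝ), ((g ^ (-B) : ℝ) : ℂ) ^ (-w) *
      ((g : ℂ) ^ ((β : ℂ) - 1) * Complex.exp (-g)) =
      (g : ℂ) ^ ((β + B * w) - 1) * Complex.exp (-g) := fun g hg => by
    have : (g : ℂ) ≠ 0 := by exact_mod_cast (ne_of_gt hg)
    rw [ofReal_rpow_cpow hg, ← mul_assoc, ← Complex.cpow_add _ _ this]
    push_cast; ring_nf
  obtain ⟨i1, i2⟩ := integral_cpow_mul_exp_neg (w := β + B * w) (by simp; positivity)
  have H := hasMellin_superposition (h := fun z : ℝ => ((1 + z : ℝ) : ℂ) ^ (-s))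
    (c := fun g : ℝ => (g : ℂ) ^ ((β : ℂ) - 1) * Complex.exp (-g)) (Q := fun g => g ^ (-B))
    (w := w) (hasMellin_one_add_cpow_neg hw hs).1 (by fun_prop) (by fun_prop) (by fun_prop)
    (fun g hg => by positivity)
    (i1.congr_fun (fun g hg => (e g hg).symm) measurableSet_Ioi)
  rw [setIntegral_congr_fun measurableSet_Ioi e, i2, (hasMellin_one_add_cpow_neg hw hs).2] at H
  exact H

/-- The function with Mellin transform `Γ(α + A s)`. -/
def powGammaKernel (α A z : ℝ) : ℝ := z ^ (α / A) * Real.exp (-z ^ (1 / A)) / A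

/-- The substitution `z = g^A` in Euler's integral, `powGammaKernel` being `A⁻¹ g^α e^(-g)` at `g =
z^(1/A)`. -/
lemma hasMellin_powGammaKernel {α A : ℝ} (hA : 0 < A) {s : ℂ} (hs : 0 < α + A * s.re) :
    HasMellin (fun z => (powGammaKernel α A z : ℂ)) s (Complex.Gamma (α + A * s)) := by
  have hA' : (A : ℂ) ≠ 0 := by exact_mod_cast hA.ne'
  have h0 := hasMellin_exp_neg (w := α + A * s) (by simpa using hs)
  have h1 : MellinConvergent (fun z : ℝ => (z : ℂ) ^ (α : ℂ) • Complex.exp (-z))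
      (s / ((1 / A : ℝ) : ℂ)) := by
    rw [MellinConvergent.cpow_smul]
    convert h0.1 using 1
    push_cast; field_simp; ring
  have h2 : mellin (fun z : ℝ => (z : ℂ) ^ (α : ℂ) • Complex.exp (-z))
      (s / ((1 / A : ℝ) : ℂ)) = Complex.Gamma (α + A * s) := by
    rw [mellin_cpow_smul, ← h0.2]
    congr 1
    push_cast; field_simp; ring
  have h3 := (MellinConvergent.comp_rpow (one_div_ne_zero hA.ne')).2 h1
  have h4 := hasMellin_const_smul h3 (A⁻¹ : ℂ)
  rw [mellin_comp_rpow (fun z : ℝ => (z : ℂ) ^ (α : ℂ) • Complex.exp (-z)), h2] at h4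
  have e : ∀ z ∈ Ioi (0 : ℝ), (powGammaKernel α A z : ℂ) = (A⁻¹ : ℂ) •
      (((z ^ (1 / A) : ℝ) : ℂ) ^ (α : ℂ) • Complex.exp (-((z ^ (1 / A) : ℝ) : ℂ))) := by
    intro z hz
    have hz : 0 < z := hz
    rw [powGammaKernel, ← Complex.ofReal_cpow (by positivity), ← Real.rpow_mul hz.le]
    push_cast
    simp only [smul_eq_mul]
    rw [one_div_mul_eq_div]
    ring
  constructor
  · refine IntegrableOn.congr_fun h4.1 (fun z hz => ?_) measurableSet_Ioi
    simp only; rw [e z hz]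
  · have : mellin (fun z => (powGammaKernel α A z : ℂ)) s =
        (A⁻¹ : ℂ) • |1 / A|⁻¹ • Complex.Gamma (α + A * s) := by
      refine Eq.trans ?_ h4.2
      refine setIntegral_congr_fun measurableSet_Ioi fun z hz => ?_
      simp only; rw [e z hz]
    rw [this, abs_of_pos (by positivity)]
    simp only [one_div, inv_inv, Complex.real_smul, smul_eq_mul]
    field_simp

/-! ### Evaluation of the Mellin-Barnes integrals -/

lemma norm_one_add_cpow_neg_le {k : ℝ} (hk : 1 ≤ k) {s : ℂ} (hs : 0 < s.re) :
    ‖(k : ℂ) ^ (-s)‖ ≤ 1 := by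
  rw [Complex.norm_cpow_eq_rpow_re_of_pos (by linarith)]
  exact Real.rpow_le_one_of_one_le_of_nonpos hk (by simpa using hs.le)

/-- Mellin inversion at `y` requires this continuity. The weight itself dominates, since `1 + g^(-B)
y ≥ 1`. -/
lemma continuousAt_relayMoment {β B : ℝ} (hβ : 0 < β) {s : ℂ} (hs : 0 < s.re)
    {y : ℝ} (hy : 0 < y) : ContinuousAt (relayMoment β B s) y := by
  have hi := (integral_cpow_mul_exp_neg (w := β) (by simpa using hβ)).1
  refine continuousAt_of_dominated (bound := fun g : ℝ =>
    ‖(g : ℂ) ^ ((β : ℂ) - 1) * Complex.exp (-g)‖) ?_ ?_ hi.norm ?_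
  · refine Eventually.of_forall fun y => Measurable.aestronglyMeasurable ?_
    fun_prop
  · filter_upwards [lt_mem_nhds hy] with y' hy'
    filter_upwards [ae_restrict_mem measurableSet_Ioi] with g hg
    have hg : 0 < g := hg
    rw [norm_mul]
    refine mul_le_of_le_one_right (norm_nonneg _) (norm_one_add_cpow_neg_le ?_ hs)
    have : 0 < g ^ (-B) * y' := by positivity
    linarith
  · filter_upwards [ae_restrict_mem measurableSet_Ioi] with g hg
    have hg : 0 < g := hg
    refine continuousAt_const.mul (ContinuousAt.cpow (by fun_prop) continuousAt_const ?_)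
    exact Complex.ofReal_mem_slitPlane.2 (by positivity)

lemma integral_neg_contour (f : ℝ → ℂ) : ∫ v : ℝ, f (-v) = ∫ v : ℝ, f v :=
  integral_neg_eq_self f volume

/-- Mellin inversion of `relayMoment` on the line `Re w = -τ`, where `w = -t`. The hypotheses on `τ`
say exactly that this line lies in the Beta strip `0 < Re w < Re s`. -/
lemma integral_second_contour {β B : ℝ} (hβ : 0 < β) (hB : 0 < B) {s : ℂ} {τ : ℝ} (hτ : τ < 0)
    (hs : 0 < s.re + τ) {y : ℝ} (hy : 0 < y) :
    ∫ v : ℝ, Complex.Gamma (s + (τ + v * Complex.I)) * Complex.Gamma (-(τ + v * Complex.I)) /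
        Complex.Gamma s * Complex.Gamma (β - B * (τ + v * Complex.I)) *
        (y : ℂ) ^ (τ + v * Complex.I) =
      2 * Real.pi * relayMoment β B s y := by
  have hw : ∀ v : ℝ, (((-τ : ℝ) : ℂ) + v * Complex.I).re = -τ := by simp
  have hM : ∀ v : ℝ, HasMellin (relayMoment β B s) (((-τ : ℝ) : ℂ) + v * Complex.I) _ :=
    fun v => hasMellin_relayMoment hβ hB (by rw [hw]; linarith) (by rw [hw]; linarith)
  obtain ⟨K, hK0, hK⟩ := exists_norm_beta_le s.re (-τ) (by linarith) (by linarith)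
  have hs0 : 0 < s.re := by linarith
  have hG : Complex.Gamma s ≠ 0 := Complex.Gamma_ne_zero_of_re_pos hs0
  have hv : Complex.VerticalIntegrable (mellin (relayMoment β B s)) (-τ) := by
    have i1 := (Complex.integrable_Gamma_vertical_mul (a := β + B * (-τ)) (A := B)
      (by nlinarith) hB.ne').norm.mul_const K
    refine i1.mono' ?_ (Eventually.of_forall fun v => ?_)
    · have : (fun v : ℝ => mellin (relayMoment β B s) (((-τ : ℝ) : ℂ) + v * Complex.I)) =
        fun v : ℝ => _ := funext fun v => (hM v).2
      rw [this]
      refine Continuous.aestronglyMeasurable ?_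
      refine Continuous.mul (Complex.continuous_Gamma_comp (by fun_prop) ?_)
        (((Complex.continuous_Gamma_comp (by fun_prop) ?_).mul
        (Complex.continuous_Gamma_comp (by fun_prop) ?_)).div_const _)
      · intro v; simp; nlinarith
      · intro v; simp; linarith
      · intro v; simp; linarith
    · rw [(hM v).2, norm_mul]
      refine mul_le_mul (le_of_eq ?_) (hK s _ rfl (hw v)) (norm_nonneg _) (norm_nonneg _)
      congr 2; push_cast; ring
  have hinv := mellinInv_mellin_eq (-τ) (relayMoment β B s) hy (by simpa using (hM 0).1) hv
    (continuousAt_relayMoment hβ hs0 hy)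
  rw [← hinv, mellinInv, ← integral_neg_contour]
  simp only [Complex.real_smul, one_div]
  have hpi : (Real.pi : ℂ) ≠ 0 := by exact_mod_cast Real.pi_ne_zero
  push_cast
  rw [← mul_assoc, mul_inv_cancel₀ (by simp [hpi]), one_mul]
  refine integral_congr_ae (Eventually.of_forall fun v => ?_)
  have := (hM v).2
  push_cast at this
  simp only [this, smul_eq_mul]
  have e1 : s + (τ + -v * Complex.I) = s - (-τ + v * Complex.I) := by ring
  have e2 : -((τ : ℂ) + -v * Complex.I) = -τ + v * Complex.I := by ring
  have e3 : β - B * ((τ : ℂ) + -v * Complex.I) = β + B * (-τ + v * Complex.I) := by ring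
  have e4 : ((τ : ℂ) + -v * Complex.I) = -(-τ + v * Complex.I) := by ring
  rw [e1, e2, e3, e4]
  ring

/-- `∫ g^{β-1} e^{-g} φ((1 + g^{-B} y) / x) dg`, where `φ` has Mellin transform `Γ(α + A s)`. -/
def foxValue (α A β B x y : ℝ) : ℝ :=
  ∫ g in Ioi (0 : ℝ), g ^ (β - 1) * Real.exp (-g) *
    powGammaKernel α A ((1 + g ^ (-B) * y) / x)

lemma continuousAt_powGammaKernel {α A z : ℝ} (hA : 0 < A) (hz : 0 < z) :
    ContinuousAt (powGammaKernel α A) z := by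
  unfold powGammaKernel
  have h1 : ContinuousAt (fun z : ℝ => z ^ (α / A)) z :=
    Real.continuousAt_rpow_const _ _ (Or.inl hz.ne')
  have h2 : ContinuousAt (fun z : ℝ => z ^ (1 / A)) z :=
    Real.continuousAt_rpow_const _ _ (Or.inl hz.ne')
  fun_prop (disch := exact hA.ne')

lemma integral_first_contour {α A : ℝ} (hA : 0 < A) {σ : ℝ} (hσ : 0 < α + A * σ) {k : ℝ}
    (hk : 0 < k) :
    ∫ u : ℝ, Complex.Gamma (α + A * (σ + u * Complex.I)) * (k : ℂ) ^ (-(σ + u * Complex.I)) =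
      2 * Real.pi * powGammaKernel α A k := by
  have hM : ∀ u : ℝ, HasMellin (fun z => (powGammaKernel α A z : ℂ)) (σ + u * Complex.I) _ :=
    fun u => hasMellin_powGammaKernel hA (by simpa using hσ)
  have hv : Complex.VerticalIntegrable (mellin fun z => (powGammaKernel α A z : ℂ)) σ := by
    refine (Complex.integrable_Gamma_vertical_mul (a := α + A * σ) hσ hA.ne').congr
      (Eventually.of_forall fun u => ?_)
    simp only [(hM u).2]
    congr 1; push_cast; ring
  have hinv := mellinInv_mellin_eq σ (fun z => (powGammaKernel α A z : ℂ)) hk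
    (by simpa using (hM 0).1) hv
    (Complex.continuous_ofReal.continuousAt.comp (continuousAt_powGammaKernel hA hk))
  rw [← hinv, mellinInv]
  simp only [Complex.real_smul, one_div]
  have hpi : (Real.pi : ℂ) ≠ 0 := by exact_mod_cast Real.pi_ne_zero
  push_cast
  rw [← mul_assoc, mul_inv_cancel₀ (by simp [hpi]), one_mul]
  refine integral_congr_ae (Eventually.of_forall fun u => ?_)
  simp only [(hM u).2, smul_eq_mul]
  exact mul_comm _ _

section Fox

variable {J : FoxJointParams} {P Q : FoxParams} {α A β B : ℝ}

/-- The kernels and the separation condition of the function `H_{α,A;β,B}`. -/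
structure IsRelayFox (J : FoxJointParams) (P Q : FoxParams) (α A β B : ℝ) : Prop where
  kernel : ∀ s t, J.kernel s t * P.kernel s * Q.kernel t =
    Complex.Gamma (s + t) * (Complex.Gamma (α + A * s) / Complex.Gamma s) *
      (Complex.Gamma (-t) * Complex.Gamma (β - B * t))
  separates : ∀ σ τ : ℝ, FoxSeparates J P Q σ τ ↔
    0 < σ + τ ∧ 0 < α + A * σ ∧ τ < 0 ∧ 0 < β - B * τ

/-- `Γ(s+t)Γ(-t)/Γ(s)` is bounded uniformly in both imaginary parts, so the integrand is dominated
by a product of two integrable functions of one variable. -/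
lemma IsRelayFox.integrable (h : IsRelayFox J P Q α A β B) (hA : 0 < A) (hB : 0 < B)
    {x y : ℝ} (hx : 0 < x) (hy : 0 < y) {σ τ : ℝ} (hs : FoxSeparates J P Q σ τ) :
    Integrable fun z : ℝ × ℝ =>
      foxIntegrand J P Q x y (σ + z.1 * Complex.I) (τ + z.2 * Complex.I) := by
  obtain ⟨h1, h2, h3, h4⟩ := (h.separates σ τ).1 hs
  obtain ⟨K, hK0, hK⟩ := exists_norm_beta_le σ (-τ) (by linarith) (by linarith)
  have i1 := (Complex.integrable_Gamma_vertical_mul h2 hA.ne').norm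
  have i2 := (Complex.integrable_Gamma_vertical_mul (A := -B) h4 (by linarith)).norm
  refine ((i1.mul_prod i2).const_mul (K * x ^ σ * y ^ τ)).mono' ?_
    (Eventually.of_forall fun z => ?_)
  · simp only [foxIntegrand, h.kernel]
    refine Continuous.aestronglyMeasurable ?_
    refine Continuous.mul (Continuous.mul (Continuous.mul (Continuous.mul ?_
      (Continuous.div ?_ ?_ ?_)) (Continuous.mul ?_ ?_)) ?_) ?_
    · exact Complex.continuous_Gamma_comp (by fun_prop) (by intro z; simp; linarith)
    · exact Complex.continuous_Gamma_comp (by fun_prop) (by intro z; simpa using h2)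
    · exact Complex.continuous_Gamma_comp (by fun_prop) (by intro z; simp; linarith)
    · intro z
      exact Complex.Gamma_ne_zero_of_re_pos (by simp; linarith)
    · exact Complex.continuous_Gamma_comp (by fun_prop) (by intro z; simp; linarith)
    · exact Complex.continuous_Gamma_comp (by fun_prop) (by intro z; simpa using h4)
    · exact Continuous.const_cpow (by fun_prop) (Or.inl (by exact_mod_cast hx.ne'))
    · exact Continuous.const_cpow (by fun_prop) (Or.inl (by exact_mod_cast hy.ne'))
  · simp only [foxIntegrand, h.kernel]
    have hb := hK (σ + z.1 * Complex.I) (-(τ + z.2 * Complex.I)) (by simp) (by simp)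
    rw [sub_neg_eq_add] at hb
    rw [norm_mul, norm_mul, Complex.norm_cpow_eq_rpow_re_of_pos hx,
      Complex.norm_cpow_eq_rpow_re_of_pos hy]
    have e1 : (α : ℂ) + A * (σ + z.1 * Complex.I) =
      ((α + A * σ : ℝ) : ℂ) + A * z.1 * Complex.I := by push_cast; ring
    have e2 : (β : ℂ) - B * (τ + z.2 * Complex.I) =
      ((β - B * τ : ℝ) : ℂ) + ((-B : ℝ) : ℂ) * z.2 * Complex.I := by push_cast; ring
    rw [e1, e2]
    set G1 := Complex.Gamma (((α + A * σ : ℝ) : ℂ) + A * z.1 * Complex.I)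
    set G2 := Complex.Gamma (((β - B * τ : ℝ) : ℂ) + ((-B : ℝ) : ℂ) * z.2 * Complex.I)
    rw [show ∀ a b c : ℂ, a * (G1 / b) * (c * G2) = (c * a / b) * (G1 * G2) by
      intros; ring, norm_mul, norm_mul G1]
    simp only [Complex.add_re, Complex.ofReal_re, Complex.mul_re, Complex.I_re, mul_zero,
      Complex.ofReal_im, Complex.I_im, mul_one, sub_self, add_zero]
    calc _ ≤ K * (‖G1‖ * ‖G2‖) * x ^ σ * y ^ τ := by gcongr
      _ = _ := by ring

/-- The inner integral is a multiple of `relayMoment`; after exchanging the `s`- and `g`-integrals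
the outer one is inverted at `(1 + g^(-B) y)/x`. Each inversion contributes `2π`, cancelling the
prefactor. -/
lemma IsRelayFox.contourIntegral_eq (h : IsRelayFox J P Q α A β B) (hA : 0 < A) (hβ : 0 < β)
    (hB : 0 < B) {x y : ℝ} (hx : 0 < x) (hy : 0 < y) {σ τ : ℝ} (hs : FoxSeparates J P Q σ τ) :
    foxContourIntegral J P Q x y σ τ = foxValue α A β B x y := by
  obtain ⟨h1, h2, h3, h4⟩ := (h.separates σ τ).1 hs
  have hσ : 0 < σ := by linarith
  have inner : ∀ u : ℝ, ∫ v : ℝ, foxIntegrand J P Q x y (σ + u * Complex.I)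
      (τ + v * Complex.I) * Complex.I = Complex.I * (2 * Real.pi) *
      (Complex.Gamma (α + A * (σ + u * Complex.I)) * (x : ℂ) ^ (σ + u * Complex.I) *
      relayMoment β B (σ + u * Complex.I) y) := by
    intro u
    have := integral_second_contour hβ hB (s := σ + u * Complex.I) h3 (by simpa using h1) hy
    rw [show ∀ a b c d e: ℂ, a * b * (c * d * e) = a * c * d * (b * e) by intros; ring,
      ← this, ← integral_const_mul]
    refine integral_congr_ae (Eventually.of_forall fun v => ?_)
    simp only [foxIntegrand, h.kernel]
    ring
  have swap : ∫ u : ℝ, Complex.Gamma (α + A * (σ + u * Complex.I)) *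
      (x : ℂ) ^ (σ + u * Complex.I) * relayMoment β B (σ + u * Complex.I) y =
      2 * Real.pi * foxValue α A β B x y := by
    have hi := (integral_cpow_mul_exp_neg (w := β) (by simpa using hβ)).1
    have hk : ∀ g ∈ Ioi (0 : ℝ), 1 ≤ 1 + g ^ (-B) * y := fun g hg => by
      have hg : 0 < g := hg
      have : 0 < g ^ (-B) * y := by positivity
      linarith
    have hGc : Continuous fun u : ℝ => Complex.Gamma (α + A * (σ + u * Complex.I)) :=
      Complex.continuous_Gamma_comp (by fun_prop) (by intro z; simpa using h2)
    simp only [relayMoment, ← integral_const_mul]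
    rw [integral_integral_swap]
    · rw [foxValue, ← integral_complex_ofReal, ← integral_const_mul]
      refine setIntegral_congr_fun measurableSet_Ioi fun g hg => ?_
      have hg' : 0 < g := hg
      have hk' : 0 < 1 + g ^ (-B) * y := by linarith [hk g hg]
      have := integral_first_contour (α := α) hA h2 (k := (1 + g ^ (-B) * y) / x) (by positivity)
      simp only [Complex.ofReal_mul, Complex.ofReal_exp, Complex.ofReal_neg]
      rw [Complex.ofReal_cpow hg'.le, mul_left_comm, ← this, ← integral_const_mul]
      refine integral_congr_ae (Eventually.of_forall fun u => ?_)
      have e : (((1 + g ^ (-B) * y) / x : ℝ) : ℂ) ^ (-(σ + u * Complex.I)) =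
          (x : ℂ) ^ (σ + u * Complex.I) *
            ((1 + g ^ (-B) * y : ℝ) : ℂ) ^ (-(σ + u * Complex.I)) := by
        rw [div_eq_mul_inv, Complex.ofReal_mul,
          Complex.mul_cpow_ofReal_nonneg hk'.le (by positivity), mul_comm, Complex.ofReal_inv, Complex.inv_cpow, ← Complex.cpow_neg, neg_neg]
        rw [Complex.arg_ofReal_of_nonneg hx.le]
        exact Real.pi_pos.ne
      simp only
      rw [e]
      push_cast
      ring
    -- Domination for Fubini: `(1 + g^(-B) y)^(-s)` has norm at most one because `σ > 0`, which
    -- leaves a product of a function of `u` and one of `g`.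
    · have i1 := (Complex.integrable_Gamma_vertical_mul h2 hA.ne').norm
      refine ((i1.mul_prod hi.norm).const_mul (x ^ σ)).mono' ?_ ?_
      · refine Measurable.aestronglyMeasurable ?_
        refine Measurable.mul (Measurable.mul (hGc.measurable.comp measurable_fst) ?_) ?_ <;>
          fun_prop
      · have hae : ∀ᵐ z : ℝ × ℝ ∂(volume.prod (volume.restrict (Ioi 0))), z.2 ∈ Ioi (0 : ℝ) :=
          Measure.quasiMeasurePreserving_snd.ae (ae_restrict_mem measurableSet_Ioi)
        filter_upwards [hae] with z hz
        have e1 : (α : ℂ) + A * (σ + z.1 * Complex.I) =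
          ((α + A * σ : ℝ) : ℂ) + A * z.1 * Complex.I := by push_cast; ring
        simp only [Function.uncurry]
        rw [norm_mul, norm_mul, norm_mul, Complex.norm_cpow_eq_rpow_re_of_pos hx, e1]
        have := norm_one_add_cpow_neg_le (hk z.2 hz) (s := σ + z.1 * Complex.I) (by simpa using hσ)
        simp only [Complex.add_re, Complex.ofReal_re, Complex.mul_re, Complex.I_re, mul_zero,
          Complex.ofReal_im, Complex.I_im, mul_one, sub_self, add_zero]
        calc _ ≤ ‖Complex.Gamma (((α + A * σ : ℝ) : ℂ) + A * z.1 * Complex.I)‖ * x ^ σ *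
              (‖(z.2 : ℂ) ^ ((β : ℂ) - 1) * Complex.exp (-z.2)‖ * 1) := by gcongr
          _ = _ := by ring
  rw [foxContourIntegral]
  simp only [inner]
  have hpi : (Real.pi : ℂ) ≠ 0 := by exact_mod_cast Real.pi_ne_zero
  rw [integral_mul_const, integral_const_mul, swap]
  have hI : Complex.I ≠ 0 := Complex.I_ne_zero
  field_simp

lemma IsRelayFox.exists_separates (h : IsRelayFox J P Q α A β B) (hα : 0 < α) (hA : 0 < A)
    (hβ : 0 < β) (hB : 0 < B) : ∃ σ τ : ℝ, FoxSeparates J P Q σ τ :=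
  ⟨2, -1, (h.separates _ _).2 ⟨by norm_num, by positivity, by norm_num, by linarith⟩⟩

lemma IsRelayFox.bivariateFoxH_eq (h : IsRelayFox J P Q α A β B) (hα : 0 < α) (hA : 0 < A)
    (hβ : 0 < β) (hB : 0 < B) {x y : ℝ} (hx : 0 < x) (hy : 0 < y) :
    bivariateFoxH J P Q x y = foxValue α A β B x y := by
  obtain ⟨σ, τ, hs⟩ := h.exists_separates hα hA hβ hB
  have hex : ∃ z : ℝ × ℝ, FoxSeparates J P Q z.1 z.2 := ⟨(σ, τ), hs⟩
  rw [bivariateFoxH, dif_pos hex]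
  exact h.contourIntegral_eq hA hβ hB hx hy hex.choose_spec

lemma IsRelayFox.converges (h : IsRelayFox J P Q α A β B) (hα : 0 < α) (hA : 0 < A)
    (hβ : 0 < β) (hB : 0 < B) {x y : ℝ} (hx : 0 < x) (hy : 0 < y) :
    BivariateFoxHConverges J P Q x y :=
  ⟨h.exists_separates hα hA hβ hB, fun _ _ hs => ⟨h.integrable hA hB hx hy hs, by
    rw [h.contourIntegral_eq hA hβ hB hx hy hs, h.bivariateFoxH_eq hα hA hβ hB hx hy]⟩⟩

end Fox

lemma isRelayFox_exp_exp (r₁ r₂ : ℕ) :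
    IsRelayFox jointPar (firstExpPar r₁) (secondExpPar r₂) 1 r₁ 1 r₂ := by
  constructor <;> intros <;>
    simp [FoxJointParams.kernel, FoxParams.kernel, jointPar, firstExpPar, secondExpPar,
      FoxSeparates, FoxParams.Separates]

lemma isRelayFox_exp_GG (p : EGGParams) (r₁ r₂ : ℕ) :
    IsRelayFox jointPar (firstExpPar r₁) (secondGGPar p r₂) 1 r₁ p.a (r₂ / p.c) := by
  constructor <;> intros <;>
    simp [FoxJointParams.kernel, FoxParams.kernel, jointPar, firstExpPar, secondGGPar,
      FoxSeparates, FoxParams.Separates]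

lemma isRelayFox_GG_exp (p : EGGParams) (r₁ r₂ : ℕ) :
    IsRelayFox jointPar (firstGGPar p r₁) (secondExpPar r₂) p.a (r₁ / p.c) 1 r₂ := by
  constructor <;> intros <;>
    simp [FoxJointParams.kernel, FoxParams.kernel, jointPar, firstGGPar, secondExpPar,
      FoxSeparates, FoxParams.Separates]

lemma isRelayFox_GG_GG (p q : EGGParams) (r₁ r₂ : ℕ) :
    IsRelayFox jointPar (firstGGPar p r₁) (secondGGPar q r₂) p.a (r₁ / p.c) q.a (r₂ / q.c) := by
  constructor <;> intros <;>
    simp [FoxJointParams.kernel, FoxParams.kernel, jointPar, firstGGPar, secondGGPar,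
      FoxSeparates, FoxParams.Separates]

/-! ### The integrals `foxValue` -/

/-- Raise `w/α ≤ e^(w/α)` to the power `α`. -/
lemma Real.rpow_mul_exp_neg_le {α w : ℝ} (hα : 0 < α) (hw : 0 < w) :
    w ^ α * Real.exp (-w) ≤ α ^ α := by
  have h1 : w / α ≤ Real.exp (w / α) := by linarith [Real.add_one_le_exp (w / α)]
  have h2 := Real.rpow_le_rpow (by positivity) h1 hα.le
  rw [← Real.exp_mul, div_mul_cancel₀ _ hα.ne', Real.div_rpow hw.le hα.le,
    div_le_iff₀ (by positivity)] at h2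
  rw [Real.exp_neg, ← div_eq_mul_inv, div_le_iff₀ (Real.exp_pos _), mul_comm]
  exact h2

lemma powGammaKernel_nonneg {α A z : ℝ} (hA : 0 < A) (hz : 0 < z) : 0 ≤ powGammaKernel α A z := by
  unfold powGammaKernel; positivity

/-- Uniformity in `z` makes the Gamma weight a dominating function for `foxValue`. -/
lemma powGammaKernel_le {α A z : ℝ} (hα : 0 < α) (hA : 0 < A) (hz : 0 < z) :
    powGammaKernel α A z ≤ α ^ α / A := by
  have := Real.rpow_mul_exp_neg_le hα (w := z ^ (1 / A)) (by positivity)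
  rw [← Real.rpow_mul hz.le, one_div_mul_eq_div] at this
  unfold powGammaKernel
  gcongr

lemma norm_powGammaKernel_le {α A z : ℝ} (hα : 0 < α) (hA : 0 < A) (hz : 0 < z) :
    ‖powGammaKernel α A z‖ ≤ α ^ α / A := by
  rw [Real.norm_of_nonneg (powGammaKernel_nonneg hA hz)]
  exact powGammaKernel_le hα hA hz

@[fun_prop]
lemma measurable_powGammaKernel {α A : ℝ} : Measurable (powGammaKernel α A) := by
  unfold powGammaKernel; fun_prop

lemma integrableOn_rpow_mul_exp_neg {β : ℝ} (hβ : 0 < β) :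
    IntegrableOn (fun g : ℝ => g ^ (β - 1) * Real.exp (-g)) (Ioi 0) :=
  (Real.GammaIntegral_convergent hβ).congr_fun (fun _ _ => mul_comm _ _) measurableSet_Ioi

section FoxValue

variable {α A β B x y : ℝ}

lemma integrableOn_foxValue (hα : 0 < α) (hA : 0 < A) (hβ : 0 < β) (hx : 0 < x) (hy : 0 < y) :
    IntegrableOn (fun g : ℝ => g ^ (β - 1) * Real.exp (-g) *
      powGammaKernel α A ((1 + g ^ (-B) * y) / x)) (Ioi 0) := by
  refine Integrable.mul_bdd (c := α ^ α / A) (integrableOn_rpow_mul_exp_neg hβ)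
    (Measurable.aestronglyMeasurable (by fun_prop)) ?_
  filter_upwards [ae_restrict_mem measurableSet_Ioi] with g hg
  have hg : 0 < g := hg
  exact norm_powGammaKernel_le hα hA (by positivity)

@[fun_prop]
lemma measurable_foxValue : Measurable fun x => foxValue α A β B x y := by
  unfold foxValue
  exact (StronglyMeasurable.integral_prod_right (f := fun x g : ℝ => g ^ (β - 1) * Real.exp (-g) *
    powGammaKernel α A ((1 + g ^ (-B) * y) / x))
    (Measurable.stronglyMeasurable (by simp only [Function.uncurry_def]; fun_prop))).measurable

lemma foxValue_nonneg (hA : 0 < A) (hx : 0 < x) (hy : 0 < y) : 0 ≤ foxValue α A β B x y := by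
  refine setIntegral_nonneg measurableSet_Ioi fun g hg => ?_
  have hg : 0 < g := hg
  have := powGammaKernel_nonneg (α := α) hA (z := (1 + g ^ (-B) * y) / x) (by positivity)
  positivity

lemma continuousAt_foxValue (hα : 0 < α) (hA : 0 < A) (hβ : 0 < β) (hx : 0 < x) (hy : 0 < y) :
    ContinuousAt (fun x => foxValue α A β B x y) x := by
  refine continuousAt_of_dominated (bound := fun g : ℝ =>
    ‖g ^ (β - 1) * Real.exp (-g)‖ * (α ^ α / A)) ?_ ?_
    ((integrableOn_rpow_mul_exp_neg hβ).norm.mul_const _) ?_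
  · exact Eventually.of_forall fun x => Measurable.aestronglyMeasurable (by fun_prop)
  · filter_upwards [lt_mem_nhds hx] with x' hx'
    filter_upwards [ae_restrict_mem measurableSet_Ioi] with g hg
    have hg : 0 < g := hg
    rw [norm_mul]
    gcongr
    exact norm_powGammaKernel_le hα hA (by positivity)
  · filter_upwards [ae_restrict_mem measurableSet_Ioi] with g hg
    have hg : 0 < g := hg
    refine continuousAt_const.mul (ContinuousAt.comp (f := fun x => (1 + g ^ (-B) * y) / x)
      (continuousAt_powGammaKernel hA (by positivity)) ?_)
    exact continuousAt_const.div continuousAt_id hx.ne'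

end FoxValue

/-! ### Integration against Gamma weights -/

/-- `∫ F(g) g^{a-1} e^{-g} dg` over the positive half-line. -/
def gammaLIntegral (a : ℝ) (F : ℝ → ℝ≥0∞) : ℝ≥0∞ :=
  ∫⁻ g in Ioi (0 : ℝ), ENNReal.ofReal (g ^ (a - 1) * Real.exp (-g)) * F g

lemma gammaLIntegral_congr {a : ℝ} {F G : ℝ → ℝ≥0∞} (h : ∀ g, 0 < g → F g = G g) :
    gammaLIntegral a F = gammaLIntegral a G :=
  setLIntegral_congr_fun measurableSet_Ioi fun g hg => by simp only [h g hg]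

lemma gammaLIntegral_add {a : ℝ} {F G : ℝ → ℝ≥0∞} (hF : Measurable F) :
    gammaLIntegral a (fun g => F g + G g) = gammaLIntegral a F + gammaLIntegral a G := by
  simp only [gammaLIntegral, mul_add]
  exact lintegral_add_left (by fun_prop) _

lemma gammaLIntegral_const_mul {a : ℝ} (k : ℝ≥0∞) {F : ℝ → ℝ≥0∞} (hF : Measurable F) :
    gammaLIntegral a (fun g => k * F g) = k * gammaLIntegral a F := by
  simp only [gammaLIntegral, mul_left_comm _ k]
  exact lintegral_const_mul _ (by fun_prop)

lemma measurable_gammaLIntegral {X : Type*} [MeasurableSpace X] {a : ℝ} {F : X → ℝ → ℝ≥0∞}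
    (hF : Measurable (Function.uncurry F)) : Measurable fun x => gammaLIntegral a (F x) := by
  refine Measurable.lintegral_prod_right ?_
  exact Measurable.mul (by fun_prop) hF

/-- The law of `κ G^A` for a Gamma variable `G`. -/
lemma gammaLIntegral_comp_rpow {α A κ : ℝ} (hA : 0 < A) (hκ : 0 < κ) (F : ℝ → ℝ≥0∞) :
    gammaLIntegral α (fun h => F (κ * h ^ A)) =
      ∫⁻ z in Ioi (0 : ℝ), ENNReal.ofReal (powGammaKernel α A (z / κ) / z) * F z := by
  -- The change of variables is `h = (z/κ)^(1/A)`.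
  have himg : (fun z : ℝ => (z / κ) ^ (1 / A)) '' Ioi 0 = Ioi 0 := by
    ext h
    constructor
    · rintro ⟨z, hz, rfl⟩
      have hz : 0 < z := hz
      exact Real.rpow_pos_of_pos (by positivity) _
    · intro hh
      have hh : 0 < h := hh
      refine ⟨κ * h ^ A, by simp only [mem_Ioi]; positivity, ?_⟩
      simp only
      rw [mul_div_cancel_left₀ _ hκ.ne', ← Real.rpow_mul hh.le, mul_one_div_cancel hA.ne',
        Real.rpow_one]
  have hinj : InjOn (fun z : ℝ => (z / κ) ^ (1 / A)) (Ioi 0) := by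
    intro z hz z' hz' h
    have hz : 0 < z := hz
    have hz' : 0 < z' := hz'
    have := (Real.rpow_left_inj (by positivity) (by positivity) (one_div_ne_zero hA.ne')).1 h
    rwa [div_left_inj' hκ.ne'] at this
  rw [gammaLIntegral, ← himg, lintegral_image_eq_lintegral_abs_deriv_mul measurableSet_Ioi
    (f' := fun z => (1 / A) * (z / κ) ^ (1 / A - 1) * (1 / κ)) ?_ hinj, himg]
  · refine setLIntegral_congr_fun measurableSet_Ioi fun z hz => ?_
    have hz : 0 < z := hz
    have hq : 0 < z / κ := by positivity
    rw [← mul_assoc, ← ENNReal.ofReal_mul (abs_nonneg _), abs_of_nonneg (by positivity),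
      ← Real.rpow_mul hq.le (1 / A) A, one_div_mul_cancel hA.ne', Real.rpow_one,
      mul_div_cancel₀ _ hκ.ne']
    congr 2
    -- Exponents: `(1/A - 1) + (α - 1)/A = α/A - 1`.
    have e : (z / κ) ^ (1 / A - 1) * ((z / κ) ^ (1 / A)) ^ (α - 1) =
        (z / κ) ^ (α / A) / (z / κ) := by
      rw [← Real.rpow_mul hq.le, ← Real.rpow_add hq, ← Real.rpow_sub_one hq.ne']
      congr 1
      field_simp
      ring
    rw [show ∀ a b c d e : ℝ, a * b * c * (d * e) = a * c * (b * d) * e by intros; ring, e,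
      powGammaKernel]
    field_simp
  · intro z hz
    have hz : 0 < z := hz
    have h1 := (Real.hasDerivAt_rpow_const (x := z / κ) (p := 1 / A)
      (Or.inl (by positivity))).comp z ((hasDerivAt_id z).div_const κ)
    exact h1.hasDerivWithinAt

lemma gammaLIntegral_sq {a b p : ℝ} (ha : 0 < a) (hp : 0 < p) :
    gammaLIntegral a (fun g => ENNReal.ofReal ((b * g ^ p) ^ 2)) =
      ENNReal.ofReal (b ^ 2 * Real.Gamma (a + 2 * p)) := by
  have hap : 0 < a + 2 * p := by positivity
  rw [Real.Gamma_eq_integral hap, ← integral_const_mul, ofReal_integral_eq_lintegral_ofReal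
    ((Real.GammaIntegral_convergent hap).const_mul _)]
  · refine setLIntegral_congr_fun measurableSet_Ioi fun g hg => ?_
    have hg : 0 < g := hg
    simp only
    rw [← ENNReal.ofReal_mul (by positivity)]
    congr 1
    rw [show a + 2 * p - 1 = (a - 1) + (p + p) by ring, Real.rpow_add hg, Real.rpow_add hg]
    ring
  · filter_upwards [ae_restrict_mem measurableSet_Ioi] with g hg
    have hg : 0 < g := hg
    simp only [Pi.zero_apply]
    positivity

/-! ### The Exponential-Generalized Gamma distribution -/

/-- Puts both components in the shape produced by `gammaLIntegral_comp_rpow`, with `(α, A, κ)` equal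
to `(1, 1, λ)` and `(a, 1/c, b)`. -/
lemma eggPDF_eq (p : EGGParams) {x : ℝ} (hx : 0 < x) :
    eggPDF p x = p.ω * (powGammaKernel 1 1 (x / p.lam) / x) +
      (1 - p.ω) / Real.Gamma p.a * (powGammaKernel p.a (1 / p.c) (x / p.b) / x) := by
  have hb := p.b_pos
  have hc := p.c_pos
  have hl := p.lam_pos
  have hG := Real.Gamma_pos_of_pos p.a_pos
  rw [eggPDF, if_pos hx, powGammaKernel, powGammaKernel, div_self one_ne_zero, Real.rpow_one, div_one,
    one_div_one_div, div_div_eq_mul_div, div_one,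
    show p.a / (1 / p.c) = p.a * p.c by field_simp, Real.div_rpow hx.le hb.le (p.a * p.c),
    Real.rpow_sub_one hx.ne']
  field_simp

lemma measurable_eggPDF (p : EGGParams) : Measurable (eggPDF p) := by
  unfold eggPDF
  exact Measurable.ite measurableSet_Ioi (by fun_prop) measurable_const

/-- The exponent 1 is kept so that both components are scaled powers and one computation of the SNR
law covers all four pairs. -/
lemma lintegral_eggMeasure (p : EGGParams) {F : ℝ → ℝ≥0∞} (hF : Measurable F) :
    ∫⁻ x, F x ∂eggMeasure p =
      ENNReal.ofReal p.ω * gammaLIntegral 1 (fun g => F (p.lam * g ^ (1 : ℝ))) +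
      ENNReal.ofReal ((1 - p.ω) / Real.Gamma p.a) *
        gammaLIntegral p.a (fun g => F (p.b * g ^ (1 / p.c))) := by
  have hG := Real.Gamma_pos_of_pos p.a_pos
  have hω := p.ω_lt_one
  have hc := p.c_pos
  have hb := p.b_pos
  have hl := p.lam_pos
  rw [eggMeasure, lintegral_withDensity_eq_lintegral_mul _ (measurable_eggPDF p).ennreal_ofReal hF,
    gammaLIntegral_comp_rpow one_pos p.lam_pos, gammaLIntegral_comp_rpow (by positivity) p.b_pos,
    ← lintegral_const_mul _ (by fun_prop), ← lintegral_const_mul _ (by fun_prop),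
    ← lintegral_add_left (by fun_prop), ← setLIntegral_eq_of_support_subset (s := Ioi 0)]
  · refine setLIntegral_congr_fun measurableSet_Ioi fun x hx => ?_
    have hx : 0 < x := hx
    have h1 := powGammaKernel_nonneg (α := 1) one_pos (z := x / p.lam) (by positivity)
    have h2 := powGammaKernel_nonneg (α := p.a) (A := 1 / p.c) (by positivity)
      (z := x / p.b) (by positivity)
    have h3 : 0 ≤ 1 - p.ω := by linarith
    have h4 := p.ω_pos
    simp only [Pi.mul_apply]
    rw [← mul_assoc, ← mul_assoc, ← ENNReal.ofReal_mul h4.le, ← ENNReal.ofReal_mul (by positivity),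
      ← add_mul, ← ENNReal.ofReal_add (by positivity) (by positivity), eggPDF_eq p hx]
  · intro x hx
    by_contra h
    simp only [mem_Ioi] at h
    exact hx (by simp [eggPDF, h])

lemma integral_sq_eggMeasure (p : EGGParams) :
    ∫ x, x ^ 2 ∂eggMeasure p = 2 * p.ω * p.lam ^ 2 +
      p.b ^ 2 * (1 - p.ω) * Real.Gamma (p.a + 2 / p.c) / Real.Gamma p.a := by
  have hG := Real.Gamma_pos_of_pos p.a_pos
  have hω : 0 < 1 - p.ω := by linarith [p.ω_lt_one]
  have hω' := p.ω_pos
  have hc := p.c_pos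
  have hb := p.b_pos
  have ha := p.a_pos
  have hl := p.lam_pos
  have hG2 : 0 < Real.Gamma (p.a + 2 * (1 / p.c)) := Real.Gamma_pos_of_pos (by positivity)
  have hG3 : Real.Gamma (1 + 2 * 1) = 2 := by
    have := Real.Gamma_nat_eq_factorial 2
    norm_num at this ⊢
  rw [integral_eq_lintegral_of_nonneg_ae (Eventually.of_forall fun x => sq_nonneg x)
    (by fun_prop), lintegral_eggMeasure p (by fun_prop), gammaLIntegral_sq one_pos one_pos,
    gammaLIntegral_sq p.a_pos (by positivity), ← ENNReal.ofReal_mul hω'.le,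
    ← ENNReal.ofReal_mul (by positivity), hG3, ← ENNReal.ofReal_add (by positivity) (by positivity),
    ENNReal.toReal_ofReal (by positivity), mul_one_div]
  ring

/-! ### The law of the end-to-end SNR -/

/-- The end-to-end SNR as a function of the irradiances. -/
def relaySNR (η N₁ N₂ C : ℝ) (r₁ r₂ : ℕ) (x₁ x₂ : ℝ) : ℝ :=
  (η * x₁) ^ r₁ / N₁ * ((η * x₂) ^ r₂ / N₂) / ((η * x₂) ^ r₂ / N₂ + C)

@[fun_prop]
lemma measurable_relaySNR {X : Type*} [MeasurableSpace X] {η N₁ N₂ C : ℝ} {r₁ r₂ : ℕ}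
    {f g : X → ℝ} (hf : Measurable f) (hg : Measurable g) :
    Measurable fun x => relaySNR η N₁ N₂ C r₁ r₂ (f x) (g x) := by
  unfold relaySNR; fun_prop

section Law

variable {η N₁ N₂ C : ℝ} {r₁ r₂ : ℕ} {b₁ b₂ e₁ e₂ α β : ℝ}

/-- From `γ₁γ₂/(γ₂+C) = γ₁/(1+C/γ₂)`: for fixed `g` only a scaled power of `h` remains. -/
lemma relaySNR_rpow (hη : 0 < η) (hN₁ : 0 < N₁) (hN₂ : 0 < N₂) (hC : 0 < C)
    (hb₂ : 0 < b₂) {h g : ℝ} (hh : 0 < h) (hg : 0 < g) :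
    relaySNR η N₁ N₂ C r₁ r₂ (b₁ * h ^ e₁) (b₂ * g ^ e₂) =
      b₁ ^ r₁ * avgElectricalSNR η N₁ r₁ /
        (1 + g ^ (-(r₂ * e₂)) * (C / (b₂ ^ r₂ * avgElectricalSNR η N₂ r₂))) *
        h ^ (r₁ * e₁) := by
  have p1 : (h ^ e₁) ^ r₁ = h ^ (r₁ * e₁) := by
    rw [← Real.rpow_natCast, ← Real.rpow_mul hh.le, mul_comm]
  have p2 : (g ^ e₂) ^ r₂ = g ^ (r₂ * e₂) := by
    rw [← Real.rpow_natCast, ← Real.rpow_mul hg.le, mul_comm]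
  have hgp : 0 < g ^ (r₂ * e₂) := by positivity
  rw [relaySNR, avgElectricalSNR, avgElectricalSNR, Real.rpow_neg hg.le]
  simp only [mul_pow, p1, p2]
  field_simp

/-- The law of the end-to-end SNR when both irradiances are scaled powers of independent Gamma
variables. -/
lemma gammaLIntegral_relaySNR (hη : 0 < η) (hN₁ : 0 < N₁) (hN₂ : 0 < N₂) (hC : 0 < C)
    (hr₁ : 0 < r₁) (hb₁ : 0 < b₁) (hb₂ : 0 < b₂) (he₁ : 0 < e₁) (hα : 0 < α)
    (hβ : 0 < β) {F : ℝ → ℝ≥0∞} (hF : Measurable F) :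
    gammaLIntegral β (fun g => gammaLIntegral α fun h =>
        F (relaySNR η N₁ N₂ C r₁ r₂ (b₁ * h ^ e₁) (b₂ * g ^ e₂))) =
      ∫⁻ z in Ioi (0 : ℝ), ENNReal.ofReal (foxValue α (r₁ * e₁) β (r₂ * e₂)
        (b₁ ^ r₁ * avgElectricalSNR η N₁ r₁ / z)
        (C / (b₂ ^ r₂ * avgElectricalSNR η N₂ r₂)) / z) * F z := by
  have hA : 0 < r₁ * e₁ := by positivity
  have hK : 0 < b₁ ^ r₁ * avgElectricalSNR η N₁ r₁ := by unfold avgElectricalSNR; positivity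
  have hy : 0 < C / (b₂ ^ r₂ * avgElectricalSNR η N₂ r₂) := by unfold avgElectricalSNR; positivity
  set K := b₁ ^ r₁ * avgElectricalSNR η N₁ r₁
  set y := C / (b₂ ^ r₂ * avgElectricalSNR η N₂ r₂)
  set A := r₁ * e₁
  set B := r₂ * e₂
  have step : ∀ g, 0 < g → (gammaLIntegral α fun h =>
      F (relaySNR η N₁ N₂ C r₁ r₂ (b₁ * h ^ e₁) (b₂ * g ^ e₂))) =
      ∫⁻ z in Ioi (0 : ℝ), ENNReal.ofReal
        (powGammaKernel α A ((1 + g ^ (-B) * y) / (K / z)) / z) * F z := by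
    intro g hg
    rw [gammaLIntegral_congr (G := fun h => F (K / (1 + g ^ (-B) * y) * h ^ A)) fun h hh => by
        rw [relaySNR_rpow hη hN₁ hN₂ hC hb₂ hh hg],
      gammaLIntegral_comp_rpow hA (by positivity)]
    refine setLIntegral_congr_fun measurableSet_Ioi fun z hz => ?_
    have hz : 0 < z := hz
    congr 4
    field_simp
  rw [gammaLIntegral_congr step, gammaLIntegral]
  have hm : Measurable (fun q : ℝ × ℝ => ENNReal.ofReal (q.1 ^ (β - 1) * Real.exp (-q.1)) *
      (ENNReal.ofReal
        (powGammaKernel α A ((1 + q.1 ^ (-B) * y) / (K / q.2)) / q.2) * F q.2)) := by fun_prop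
  simp only [← lintegral_const_mul' _ _ ENNReal.ofReal_ne_top]
  -- Tonelli moves `g` inside, where its integral is `foxValue / z`.
  rw [lintegral_lintegral_swap hm.aemeasurable]
  refine setLIntegral_congr_fun measurableSet_Ioi fun z hz => ?_
  have hz : 0 < z := hz
  simp only [← mul_assoc]
  rw [lintegral_mul_const _ (by fun_prop)]
  congr 1
  rw [foxValue, ← integral_div, ofReal_integral_eq_lintegral_ofReal
    ((integrableOn_foxValue hα hA hβ (by positivity) hy).div_const z)]
  · refine setLIntegral_congr_fun measurableSet_Ioi fun g hg => ?_
    have hg : 0 < g := hg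
    rw [← ENNReal.ofReal_mul (by positivity), mul_div_assoc (g ^ (β - 1) * Real.exp (-g))]
  · filter_upwards [ae_restrict_mem measurableSet_Ioi] with g hg
    have hg : 0 < g := hg
    have := powGammaKernel_nonneg (α := α) hA (z := (1 + g ^ (-B) * y) / (K / z)) (by positivity)
    simp only [Pi.zero_apply]
    positivity

end Law

section Density

variable (p₁ p₂ : EGGParams) (r₁ r₂ : ℕ) (μ₁ μ₂ C : ℝ)

/-- The real-valued density of the end-to-end SNR. -/
def relayDensity (x : ℝ) : ℝ :=
  if 0 < x then
    p₁.ω * p₂.ω / x *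
        foxValue 1 r₁ 1 r₂ (p₁.lam ^ r₁ * μ₁ / x) (C / (p₂.lam ^ r₂ * μ₂)) +
    p₁.ω * (1 - p₂.ω) / (Real.Gamma p₂.a * x) *
        foxValue 1 r₁ p₂.a (r₂ / p₂.c) (p₁.lam ^ r₁ * μ₁ / x) (C / (p₂.b ^ r₂ * μ₂)) +
    p₂.ω * (1 - p₁.ω) / (Real.Gamma p₁.a * x) *
        foxValue p₁.a (r₁ / p₁.c) 1 r₂ (p₁.b ^ r₁ * μ₁ / x) (C / (p₂.lam ^ r₂ * μ₂)) +
    (1 - p₁.ω) * (1 - p₂.ω) / (Real.Gamma p₁.a * Real.Gamma p₂.a * x) *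
        foxValue p₁.a (r₁ / p₁.c) p₂.a (r₂ / p₂.c) (p₁.b ^ r₁ * μ₁ / x)
          (C / (p₂.b ^ r₂ * μ₂))
  else 0

variable {p₁ p₂ r₁ r₂ μ₁ μ₂ C}

lemma endToEndSNRDensity_eq (hr₁ : 0 < r₁) (hr₂ : 0 < r₂) (hμ₁ : 0 < μ₁) (hμ₂ : 0 < μ₂)
    (hC : 0 < C) {x : ℝ} (hx : 0 < x) :
    (relayDensity p₁ p₂ r₁ r₂ μ₁ μ₂ C x : ℂ) = endToEndSNRDensity p₁ p₂ r₁ r₂ μ₁ μ₂ C x := by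
  have hl₁ := p₁.lam_pos
  have ha₁ := p₁.a_pos
  have hb₁ := p₁.b_pos
  have hc₁ := p₁.c_pos
  have hl₂ := p₂.lam_pos
  have ha₂ := p₂.a_pos
  have hb₂ := p₂.b_pos
  have hc₂ := p₂.c_pos
  have hr₁' : (0 : ℝ) < r₁ := by exact_mod_cast hr₁
  have hr₂' : (0 : ℝ) < r₂ := by exact_mod_cast hr₂
  rw [relayDensity, if_pos hx, endToEndSNRDensity,
    (isRelayFox_exp_exp r₁ r₂).bivariateFoxH_eq one_pos hr₁' one_pos hr₂' (by positivity)
      (by positivity),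
    (isRelayFox_exp_GG p₂ r₁ r₂).bivariateFoxH_eq one_pos hr₁' ha₂ (by positivity) (by positivity)
      (by positivity),
    (isRelayFox_GG_exp p₁ r₁ r₂).bivariateFoxH_eq ha₁ (by positivity) one_pos hr₂' (by positivity)
      (by positivity),
    (isRelayFox_GG_GG p₁ p₂ r₁ r₂).bivariateFoxH_eq ha₁ (by positivity) ha₂ (by positivity)
      (by positivity) (by positivity)]
  push_cast
  rfl

lemma endToEndSNRDensity_converges (hr₁ : 0 < r₁) (hr₂ : 0 < r₂) (hμ₁ : 0 < μ₁) (hμ₂ : 0 < μ₂)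
    (hC : 0 < C) {x : ℝ} (hx : 0 < x) :
    EndToEndSNRDensityConverges p₁ p₂ r₁ r₂ μ₁ μ₂ C x := by
  have hl₁ := p₁.lam_pos
  have ha₁ := p₁.a_pos
  have hb₁ := p₁.b_pos
  have hc₁ := p₁.c_pos
  have hl₂ := p₂.lam_pos
  have ha₂ := p₂.a_pos
  have hb₂ := p₂.b_pos
  have hc₂ := p₂.c_pos
  have hr₁' : (0 : ℝ) < r₁ := by exact_mod_cast hr₁
  have hr₂' : (0 : ℝ) < r₂ := by exact_mod_cast hr₂
  exact ⟨(isRelayFox_exp_exp r₁ r₂).converges one_pos hr₁' one_pos hr₂' (by positivity)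
      (by positivity),
    (isRelayFox_exp_GG p₂ r₁ r₂).converges one_pos hr₁' ha₂ (by positivity) (by positivity)
      (by positivity),
    (isRelayFox_GG_exp p₁ r₁ r₂).converges ha₁ (by positivity) one_pos hr₂' (by positivity)
      (by positivity),
    (isRelayFox_GG_GG p₁ p₂ r₁ r₂).converges ha₁ (by positivity) ha₂ (by positivity)
      (by positivity) (by positivity)⟩

lemma relayDensity_nonneg (hr₁ : 0 < r₁) (hμ₁ : 0 < μ₁) (hμ₂ : 0 < μ₂)
    (hC : 0 < C) (x : ℝ) : 0 ≤ relayDensity p₁ p₂ r₁ r₂ μ₁ μ₂ C x := by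
  have hl₁ := p₁.lam_pos
  have ha₁ := p₁.a_pos
  have hb₁ := p₁.b_pos
  have hc₁ := p₁.c_pos
  have hl₂ := p₂.lam_pos
  have ha₂ := p₂.a_pos
  have hb₂ := p₂.b_pos
  have hc₂ := p₂.c_pos
  have hω₁ := p₁.ω_pos
  have hω₂ := p₂.ω_pos
  have hω₁' : 0 < 1 - p₁.ω := by linarith [p₁.ω_lt_one]
  have hω₂' : 0 < 1 - p₂.ω := by linarith [p₂.ω_lt_one]
  have hG₁ := Real.Gamma_pos_of_pos ha₁
  have hG₂ := Real.Gamma_pos_of_pos ha₂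
  have hr₁' : (0 : ℝ) < r₁ := by exact_mod_cast hr₁
  unfold relayDensity
  split_ifs with hx
  · have h := fun {α A β B X Y : ℝ} => @foxValue_nonneg α A β B X Y
    refine add_nonneg (add_nonneg (add_nonneg ?_ ?_) ?_) ?_ <;>
      exact mul_nonneg (by positivity) (h (by positivity) (by positivity) (by positivity))
  · rfl

lemma continuousAt_relayDensity (hr₁ : 0 < r₁) (hμ₁ : 0 < μ₁) (hμ₂ : 0 < μ₂)
    (hC : 0 < C) {x : ℝ} (hx : 0 < x) :
    ContinuousAt (relayDensity p₁ p₂ r₁ r₂ μ₁ μ₂ C) x := by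
  have hl₁ := p₁.lam_pos
  have ha₁ := p₁.a_pos
  have hb₁ := p₁.b_pos
  have hc₁ := p₁.c_pos
  have hl₂ := p₂.lam_pos
  have ha₂ := p₂.a_pos
  have hb₂ := p₂.b_pos
  have hc₂ := p₂.c_pos
  have hG₁ := Real.Gamma_pos_of_pos ha₁
  have hG₂ := Real.Gamma_pos_of_pos ha₂
  have hr₁' : (0 : ℝ) < r₁ := by exact_mod_cast hr₁
  have h : ∀ {k L α A β B K y : ℝ}, 0 < L → 0 < α → 0 < A → 0 < β → 0 < K → 0 < y →
      ContinuousAt (fun x => k / (L * x) * foxValue α A β B (K / x) y) x := by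
    intro k L α A β B K y hL hα hA hβ hK hy
    refine ContinuousAt.mul (continuousAt_const.div (by fun_prop) (by positivity))
      (ContinuousAt.comp (g := fun x => foxValue α A β B x y) (f := fun x => K / x)
      (continuousAt_foxValue hα hA hβ (by positivity) hy)
      (continuousAt_const.div continuousAt_id hx.ne'))
  have h0 : ∀ {k α A β B K y : ℝ}, 0 < α → 0 < A → 0 < β → 0 < K → 0 < y →
      ContinuousAt (fun x => k / x * foxValue α A β B (K / x) y) x := by
    intro k α A β B K y hα hA hβ hK hy
    simpa using h (k := k) (B := B) one_pos hα hA hβ hK hy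
  refine ContinuousAt.congr (ContinuousAt.add (ContinuousAt.add (ContinuousAt.add
    (h0 one_pos hr₁' one_pos ?_ ?_) (h ?_ one_pos hr₁' ha₂ ?_ ?_))
    (h ?_ ha₁ ?_ one_pos ?_ ?_)) (h ?_ ha₁ ?_ ha₂ ?_ ?_))
    ((eventually_gt_nhds hx).mono fun z hz => (if_pos hz).symm) <;> positivity

lemma measurable_relayDensity : Measurable (relayDensity p₁ p₂ r₁ r₂ μ₁ μ₂ C) := by
  have h : ∀ {α A β B K y : ℝ}, Measurable fun x => foxValue α A β B (K / x) y :=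
    fun {α A β B K y} => (measurable_foxValue (α := α) (A := A) (β := β) (B := B) (y := y)).comp
      (g := fun x => foxValue α A β B x y) (measurable_const.div measurable_id)
  unfold relayDensity
  refine Measurable.ite measurableSet_Ioi ?_ measurable_const
  exact (((Measurable.mul (by fun_prop) h).add (Measurable.mul (by fun_prop) h)).add
    (Measurable.mul (by fun_prop) h)).add (Measurable.mul (by fun_prop) h)

end Density

/-- Splitting both mixtures gives four pairs of components, each handled by
`gammaLIntegral_relaySNR`; the sums are then collected under a single integral. -/
lemma lintegral_relaySNR {η N₁ N₂ C : ℝ} {r₁ r₂ : ℕ} (p₁ p₂ : EGGParams) (hη : 0 < η)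
    (hN₁ : 0 < N₁) (hN₂ : 0 < N₂) (hC : 0 < C) (hr₁ : 0 < r₁)
    {F : ℝ → ℝ≥0∞} (hF : Measurable F) :
    ∫⁻ x₂, ∫⁻ x₁, F (relaySNR η N₁ N₂ C r₁ r₂ x₁ x₂) ∂eggMeasure p₁ ∂eggMeasure p₂ =
      ∫⁻ z, ENNReal.ofReal (relayDensity p₁ p₂ r₁ r₂ (avgElectricalSNR η N₁ r₁)
        (avgElectricalSNR η N₂ r₂) C z) * F z := by
  have hl₁ := p₁.lam_pos
  have ha₁ := p₁.a_pos
  have hb₁ := p₁.b_pos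
  have hc₁ := p₁.c_pos
  have hl₂ := p₂.lam_pos
  have ha₂ := p₂.a_pos
  have hb₂ := p₂.b_pos
  have hc₂ := p₂.c_pos
  have hω₁ := p₁.ω_pos
  have hω₂ := p₂.ω_pos
  have hω₁' : 0 < 1 - p₁.ω := by linarith [p₁.ω_lt_one]
  have hω₂' : 0 < 1 - p₂.ω := by linarith [p₂.ω_lt_one]
  have hG₁ := Real.Gamma_pos_of_pos ha₁
  have hG₂ := Real.Gamma_pos_of_pos ha₂
  have hr₁' : (0 : ℝ) < r₁ := by exact_mod_cast hr₁
  have hμ₁ : 0 < avgElectricalSNR η N₁ r₁ := by unfold avgElectricalSNR; positivity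
  have hμ₂ : 0 < avgElectricalSNR η N₂ r₂ := by unfold avgElectricalSNR; positivity
  have hm : ∀ a b e : ℝ, Measurable fun x₂ => gammaLIntegral a fun h =>
      F (relaySNR η N₁ N₂ C r₁ r₂ (b * h ^ e) x₂) := fun a b e =>
    measurable_gammaLIntegral (by simp only [Function.uncurry_def]; fun_prop)
  have inner : ∀ x₂, ∫⁻ x₁, F (relaySNR η N₁ N₂ C r₁ r₂ x₁ x₂) ∂eggMeasure p₁ = _ := fun x₂ =>
    lintegral_eggMeasure p₁ (F := fun x₁ => F (relaySNR η N₁ N₂ C r₁ r₂ x₁ x₂)) (by fun_prop)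
  have hm' : ∀ a b e b' e' : ℝ, Measurable fun g : ℝ => gammaLIntegral a fun h =>
      F (relaySNR η N₁ N₂ C r₁ r₂ (b * h ^ e) (b' * g ^ e')) := fun a b e b' e' =>
    (hm a b e).comp (g := fun x₂ => gammaLIntegral a fun h =>
      F (relaySNR η N₁ N₂ C r₁ r₂ (b * h ^ e) x₂)) (by fun_prop)
  have hsum : Measurable fun x₂ =>
      ENNReal.ofReal p₁.ω * gammaLIntegral 1 (fun g =>
        F (relaySNR η N₁ N₂ C r₁ r₂ (p₁.lam * g ^ (1 : ℝ)) x₂)) +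
      ENNReal.ofReal ((1 - p₁.ω) / Real.Gamma p₁.a) * gammaLIntegral p₁.a (fun g =>
        F (relaySNR η N₁ N₂ C r₁ r₂ (p₁.b * g ^ (1 / p₁.c)) x₂)) :=
    ((hm _ _ _).const_mul _).add ((hm _ _ _).const_mul _)
  simp only [inner]
  rw [lintegral_eggMeasure p₂ hsum,
    gammaLIntegral_add ((hm' _ _ _ _ _).const_mul _),
    gammaLIntegral_add ((hm' _ _ _ _ _).const_mul _),
    gammaLIntegral_const_mul _ (hm' _ _ _ _ _), gammaLIntegral_const_mul _ (hm' _ _ _ _ _),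
    gammaLIntegral_const_mul _ (hm' _ _ _ _ _), gammaLIntegral_const_mul _ (hm' _ _ _ _ _),
    gammaLIntegral_relaySNR hη hN₁ hN₂ hC hr₁ hl₁ hl₂ one_pos one_pos one_pos hF,
    gammaLIntegral_relaySNR hη hN₁ hN₂ hC hr₁ hb₁ hl₂ (by positivity) ha₁ one_pos hF,
    gammaLIntegral_relaySNR hη hN₁ hN₂ hC hr₁ hl₁ hb₂ one_pos one_pos ha₂ hF,
    gammaLIntegral_relaySNR hη hN₁ hN₂ hC hr₁ hb₁ hb₂ (by positivity) ha₁ ha₂ hF]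
  have hmF : ∀ {α A β B K y : ℝ}, Measurable fun x =>
      ENNReal.ofReal (foxValue α A β B (K / x) y / x) * F x := fun {α A β B K y} =>
    ((((measurable_foxValue (α := α) (A := A) (β := β) (B := B) (y := y)).comp
      (g := fun x => foxValue α A β B x y) (measurable_const.div measurable_id)).div
      measurable_id).ennreal_ofReal).mul hF
  have hmF₂ : ∀ {α A β B K y α' A' β' B' K' y' : ℝ} {k l : ℝ≥0∞}, Measurable fun x =>
      k * (ENNReal.ofReal (foxValue α A β B (K / x) y / x) * F x) +
      l * (ENNReal.ofReal (foxValue α' A' β' B' (K' / x) y' / x) * F x) := by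
    intros
    exact (hmF.const_mul _).add (hmF.const_mul _)
  rw [← lintegral_const_mul _ hmF, ← lintegral_const_mul _ hmF, ← lintegral_const_mul _ hmF,
    ← lintegral_const_mul _ hmF, ← lintegral_add_left (hmF.const_mul _),
    ← lintegral_add_left (hmF.const_mul _),
    ← lintegral_const_mul _ hmF₂, ← lintegral_const_mul _ hmF₂,
    ← lintegral_add_left (hmF₂.const_mul _),
    ← setLIntegral_eq_of_support_subset (s := Ioi 0)
      (f := fun z => ENNReal.ofReal (relayDensity p₁ p₂ r₁ r₂ _ _ C z) * F z)]
  · refine setLIntegral_congr_fun measurableSet_Ioi fun z hz => ?_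
    have hz : 0 < z := hz
    have hn : ∀ {α A β B K y : ℝ}, 0 < A → 0 < K → 0 < y →
        0 ≤ foxValue α A β B (K / z) y / z := fun hA hK hy =>
      div_nonneg (foxValue_nonneg hA (by positivity) hy) hz.le
    have n1 := @hn 1 (r₁ * 1) 1 (r₂ * 1) (p₁.lam ^ r₁ * avgElectricalSNR η N₁ r₁)
      (C / (p₂.lam ^ r₂ * avgElectricalSNR η N₂ r₂)) (by positivity) (by positivity) (by positivity)
    have n2 := @hn p₁.a (r₁ * (1 / p₁.c)) 1 (r₂ * 1) (p₁.b ^ r₁ * avgElectricalSNR η N₁ r₁)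
      (C / (p₂.lam ^ r₂ * avgElectricalSNR η N₂ r₂)) (by positivity) (by positivity) (by positivity)
    have n3 := @hn 1 (r₁ * 1) p₂.a (r₂ * (1 / p₂.c)) (p₁.lam ^ r₁ * avgElectricalSNR η N₁ r₁)
      (C / (p₂.b ^ r₂ * avgElectricalSNR η N₂ r₂)) (by positivity) (by positivity) (by positivity)
    have n4 := @hn p₁.a (r₁ * (1 / p₁.c)) p₂.a (r₂ * (1 / p₂.c))
      (p₁.b ^ r₁ * avgElectricalSNR η N₁ r₁)
      (C / (p₂.b ^ r₂ * avgElectricalSNR η N₂ r₂)) (by positivity) (by positivity) (by positivity)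
    have w1 : 0 ≤ (1 - p₁.ω) / Real.Gamma p₁.a := by positivity
    have w2 : 0 ≤ (1 - p₂.ω) / Real.Gamma p₂.a := by positivity
    simp only [← mul_assoc, ← add_mul]
    congr 1
    -- `ENNReal.ofReal` is additive only on nonnegative terms, hence `n1` to `n4`. The outer split
    -- is over the second hop.
    rw [← ENNReal.ofReal_mul hω₁.le, ← ENNReal.ofReal_mul hω₁.le, ← ENNReal.ofReal_mul w1,
      ← ENNReal.ofReal_mul w1, ← ENNReal.ofReal_add (mul_nonneg hω₁.le n1) (mul_nonneg w1 n2),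
      ← ENNReal.ofReal_add (mul_nonneg hω₁.le n3) (mul_nonneg w1 n4),
      ← ENNReal.ofReal_mul hω₂.le, ← ENNReal.ofReal_mul w2, ← ENNReal.ofReal_add
        (mul_nonneg hω₂.le (add_nonneg (mul_nonneg hω₁.le n1) (mul_nonneg w1 n2)))
        (mul_nonneg w2 (add_nonneg (mul_nonneg hω₁.le n3) (mul_nonneg w1 n4)))]
    congr 1
    simp only [relayDensity, if_pos hz, mul_one, mul_one_div]
    field_simp
    ring
  · intro z hz
    by_contra h
    exact hz (by simp only [relayDensity, if_neg (show ¬ 0 < z from h)]; simp)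

/-! ### Moments and the distribution function -/

/-- Pointwise `γ = μ I^r`, so the mean of `γ` is `μ` times the `r`-th moment of `I`; for `r = 2`
that moment is the stated denominator. -/
lemma avgElectricalSNRSpec_hopSNR {Ω : Type*} [MeasurableSpace Ω] {P : Measure Ω} (p : EGGParams)
    {η N : ℝ} (r : ℕ) {I : Ω → ℝ} (hI : HasLaw I (eggMeasure p) P) :
    AvgElectricalSNRSpec P p r I (hopSNR η N r I) (avgElectricalSNR η N r) := by
  have hpos : 0 < 2 * p.ω * p.lam ^ 2 +
      p.b ^ 2 * (1 - p.ω) * Real.Gamma (p.a + 2 / p.c) / Real.Gamma p.a := by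
    have hω : 0 < 1 - p.ω := by linarith [p.ω_lt_one]
    have := p.ω_pos
    have := p.lam_pos
    have := p.b_pos
    have hc := p.c_pos
    have ha := p.a_pos
    have := Real.Gamma_pos_of_pos ha
    have : 0 < Real.Gamma (p.a + 2 / p.c) := Real.Gamma_pos_of_pos (by positivity)
    positivity
  have e : ∀ w, hopSNR η N r I w = η ^ r / N * I w ^ r := fun w => by
    rw [hopSNR, mul_pow]; ring
  refine ⟨fun hr h => ?_, fun hr => ?_⟩
  · subst hr
    simp only [e, pow_one, integral_const_mul, h, mul_one, avgElectricalSNR]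
  · subst hr
    have h2 := hI.integral_comp (f := fun x : ℝ => x ^ 2) (by fun_prop)
    simp only [Function.comp_def] at h2
    simp only [e, integral_const_mul, h2, integral_sq_eggMeasure, avgElectricalSNR]
    rw [mul_div_cancel_right₀ _ hpos.ne']

lemma hasDerivAt_measureReal_Iic {f : ℝ → ℝ} (hf : Measurable f) (hf0 : ∀ x, 0 ≤ f x)
    (hfin : IsFiniteMeasure (volume.withDensity fun x => ENNReal.ofReal (f x))) {x : ℝ}
    (hx : ContinuousAt f x) :
    HasDerivAt (fun y => (volume.withDensity fun x => ENNReal.ofReal (f x)).real (Iic y))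
      (f x) x := by
  have hint : Integrable f := by
    refine ⟨hf.aestronglyMeasurable, ?_⟩
    rw [hasFiniteIntegral_iff_ofReal (Eventually.of_forall hf0)]
    have := hfin.measure_univ_lt_top
    rwa [withDensity_apply _ MeasurableSet.univ, setLIntegral_univ] at this
  -- The interval integral is based at `x` itself, so the fundamental theorem needs only continuity
  -- at `x`.
  have e : ∀ y, (volume.withDensity fun x => ENNReal.ofReal (f x)).real (Iic y) =
      (∫ z in Iic x, f z) + ∫ z in x..y, f z := by
    intro y
    rw [← intervalIntegral.integral_Iic_sub_Iic hint.integrableOn hint.integrableOn,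
      add_sub_cancel, measureReal_def, withDensity_apply _ measurableSet_Iic,
      ← ofReal_integral_eq_lintegral_ofReal hint.integrableOn (Eventually.of_forall hf0),
      ENNReal.toReal_ofReal (setIntegral_nonneg measurableSet_Iic fun z _ => hf0 z)]
  simp only [e]
  exact (intervalIntegral.integral_hasDerivAt_right (by simp)
    hf.stronglyMeasurable.stronglyMeasurableAtFilter hx).const_add _

/-- Independence turns the joint law into a product measure, and equality of measures is tested on
nonnegative measurable functions. -/
lemma hasLaw_endToEndSNR {Ω : Type*} [MeasurableSpace Ω] {P : Measure Ω} [IsProbabilityMeasure P]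
    {p₁ p₂ : EGGParams} {r₁ r₂ : ℕ} (hr₁ : 0 < r₁) {η N₁ N₂ C : ℝ} (hη : 0 < η) (hN₁ : 0 < N₁)
    (hN₂ : 0 < N₂) (hC : 0 < C) {I₁ I₂ : Ω → ℝ} (hI₁ : HasLaw I₁ (eggMeasure p₁) P)
    (hI₂ : HasLaw I₂ (eggMeasure p₂) P) (hI : IndepFun I₁ I₂ P) :
    HasLaw (endToEndSNR C (hopSNR η N₁ r₁ I₁) (hopSNR η N₂ r₂ I₂))
      (volume.withDensity fun x => ENNReal.ofReal (relayDensity p₁ p₂ r₁ r₂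
        (avgElectricalSNR η N₁ r₁) (avgElectricalSNR η N₂ r₂) C x)) P := by
  have e : endToEndSNR C (hopSNR η N₁ r₁ I₁) (hopSNR η N₂ r₂ I₂) =
      (fun q : ℝ × ℝ => relaySNR η N₁ N₂ C r₁ r₂ q.1 q.2) ∘ fun w => (I₁ w, I₂ w) := rfl
  have hm : Measurable fun q : ℝ × ℝ => relaySNR η N₁ N₂ C r₁ r₂ q.1 q.2 := by fun_prop
  have hpair : AEMeasurable (fun w => (I₁ w, I₂ w)) P :=
    hI₁.aemeasurable.prodMk hI₂.aemeasurable
  -- The EGG laws have mass one as images of `P`; no normalization integral is computed.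
  have := hI₁.isProbabilityMeasure_iff.1 inferInstance
  have := hI₂.isProbabilityMeasure_iff.1 inferInstance
  rw [e]
  refine ⟨hm.comp_aemeasurable hpair, ?_⟩
  rw [← AEMeasurable.map_map_of_aemeasurable hm.aemeasurable hpair,
    (indepFun_iff_map_prod_eq_prod_map_map hI₁.aemeasurable hI₂.aemeasurable).1 hI,
    hI₁.map_eq, hI₂.map_eq]
  refine Measure.ext_of_lintegral _ fun F hF => ?_
  rw [lintegral_map hF hm,
    lintegral_prod_symm (fun q : ℝ × ℝ => F (relaySNR η N₁ N₂ C r₁ r₂ q.1 q.2))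
      (hF.comp hm).aemeasurable,
    lintegral_relaySNR p₁ p₂ hη hN₁ hN₂ hC hr₁ hF,
    lintegral_withDensity_eq_lintegral_mul _ measurable_relayDensity.ennreal_ofReal hF]
  rfl

end

theorem theorem2 {Ω : Type*} [MeasurableSpace Ω] (P : Measure Ω) [IsProbabilityMeasure P]
    (p₁ p₂ : EGGParams) (r₁ r₂ : ℕ) (hr₁ : r₁ = 1 ∨ r₁ = 2) (hr₂ : r₂ = 1 ∨ r₂ = 2)
    (η N₁ N₂ C : ℝ) (hη : 0 < η) (hN₁ : 0 < N₁) (hN₂ : 0 < N₂) (hC : 0 < C)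
    (I₁ I₂ : Ω → ℝ) (hI₁ : HasLaw I₁ (eggMeasure p₁) P) (hI₂ : HasLaw I₂ (eggMeasure p₂) P)
    (hI : IndepFun I₁ I₂ P) :
    let γ₁ := hopSNR η N₁ r₁ I₁
    let γ₂ := hopSNR η N₂ r₂ I₂
    let γ := endToEndSNR C γ₁ γ₂
    let μ₁ := avgElectricalSNR η N₁ r₁
    let μ₂ := avgElectricalSNR η N₂ r₂
    AvgElectricalSNRSpec P p₁ r₁ I₁ γ₁ μ₁ ∧ AvgElectricalSNRSpec P p₂ r₂ I₂ γ₂ μ₂ ∧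
    (∀ x : ℝ, 0 < x → EndToEndSNRDensityConverges p₁ p₂ r₁ r₂ μ₁ μ₂ C x) ∧
    ∃ f : ℝ → ℝ, Measurable f ∧ (∀ x, 0 ≤ f x) ∧ (∀ x, x ≤ 0 → f x = 0) ∧
      (∀ x, 0 < x → (f x : ℂ) = endToEndSNRDensity p₁ p₂ r₁ r₂ μ₁ μ₂ C x) ∧
      HasLaw γ (volume.withDensity fun x => ENNReal.ofReal (f x)) P ∧
      ∀ x, 0 < x → HasDerivAt (fun y => P.real {w | γ w ≤ y}) (f x) x := by
  intro γ₁ γ₂ γ μ₁ μ₂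
  have h₁ : 0 < r₁ := by omega
  have h₂ : 0 < r₂ := by omega
  have hμ₁ : 0 < μ₁ := div_pos (pow_pos hη _) hN₁
  have hμ₂ : 0 < μ₂ := div_pos (pow_pos hη _) hN₂
  have hlaw := hasLaw_endToEndSNR (r₂ := r₂) h₁ hη hN₁ hN₂ hC hI₁ hI₂ hI
  have hn := relayDensity_nonneg (p₁ := p₁) (p₂ := p₂) (r₂ := r₂) h₁ hμ₁ hμ₂ hC
  refine ⟨avgElectricalSNRSpec_hopSNR p₁ r₁ hI₁, avgElectricalSNRSpec_hopSNR p₂ r₂ hI₂,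
    fun x hx => endToEndSNRDensity_converges h₁ h₂ hμ₁ hμ₂ hC hx,
    relayDensity p₁ p₂ r₁ r₂ μ₁ μ₂ C, measurable_relayDensity, hn,
    fun x hx => if_neg hx.not_gt, fun x hx => endToEndSNRDensity_eq h₁ h₂ hμ₁ hμ₂ hC hx,
    hlaw, fun x hx => ?_⟩
  have e : ∀ y, P.real {w | γ w ≤ y} = (volume.withDensity fun x => ENNReal.ofReal
      (relayDensity p₁ p₂ r₁ r₂ μ₁ μ₂ C x)).real (Set.Iic y) := fun y =>
    hlaw.measureReal_eq (p := fun x => x ≤ y) measurableSet_Iic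
  simp only [e]
  -- Likewise the density of `γ` has total mass one because it is the law of `γ` under `P`.
  have := hlaw.isProbabilityMeasure_iff.1 inferInstance
  exact hasDerivAt_measureReal_Iic measurable_relayDensity hn inferInstance
    (continuousAt_relayDensity h₁ hμ₁ hμ₂ hC hx)
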